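/- For a finite simple graph $G$ whose adjacency matrix has eigenvalues $\lambda_1,\dots,\lambda_n$ (counted with multiplicity), let $M_k(G)=\sum_{i=1}^n \lambda_i^k$ denote its $k$-th spectral moment and $EE(G)=\sum_{i=1}^n e^{\lambda_i}$ its Estrada index. Given $n$ and $\Delta$ such that there is a tree with $n$ vertices and maximum degree $\Delta$, the Volkmann tree $W_{n,\Delta}$ is the rooted tree with vertices $0,1,\dots,n-1$ filled level by level, from left to right: the root $0$ is joined to the children $1,\dots,\Delta$, then vertex $1$ receives the next $\Delta-1$ vertices as children, then vertex $2$ the next $\Delta-1$ vertices, and so on until the $n$ vertices are exhausted (the last vertex to receive children may receive fewer than $\Delta-1$). Thus, for $\Delta\ge 2$, each vertex $j$ with $1\le j\le\Delta$ has parent $0$ and each vertex $j>\Delta$ has parent $1+\lfloor (j-\Delta-1)/(\Delta-1)\rfloor$. Then $W_{n,\Delta}$ is a tree with $n$ vertices and maximum degree $\Delta$, and for every tree $T$ with $n$ vertices and maximum degree $\Delta$ we have $$M_{2k}(T)\le M_{2k}(W_{n,\Delta})\quad\text{for every integer } k\ge 0, \qquad\text{and}\qquad EE(T)\le EE(W_{n,\Delta}).$$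 -/

import Mathlib

/-- The `k`-th spectral moment `∑ i, λᵢ ^ k` of a finite graph, where the `λᵢ` are the eigenvalues
(with multiplicity) of its adjacency matrix. -/
noncomputable def spectralMoment {V : Type*} [Fintype V] [DecidableEq V]
    (G : SimpleGraph V) [DecidableRel G.Adj] (k : ℕ) : ℝ :=
  ∑ i, (G.isHermitian_adjMatrix ℝ).eigenvalues i ^ k

/-- The Estrada index `∑ i, exp λᵢ` of a finite graph. -/
noncomputable def estradaIndex {V : Type*} [Fintype V] [DecidableEq V]
    (G : SimpleGraph V) [DecidableRel G.Adj] : ℝ :=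
  ∑ i, Real.exp ((G.isHermitian_adjMatrix ℝ).eigenvalues i)

/-- The parent of vertex `j ≥ 1` when the vertices `0, 1, 2, …` are attached in breadth-first order,
level by level and from left to right: the root `0` receives the `Δ` children `1, …, Δ`, then
vertex `1` receives the next `Δ - 1` vertices as children, then vertex `2` the next `Δ - 1`
vertices, and so on. -/
def volkmannParent (Δ j : ℕ) : ℕ :=
  if j ≤ Δ then 0 else (j - (Δ + 1)) / (Δ - 1) + 1

/-- The Volkmann tree with `n` vertices and maximum degree `Δ` (meaningful when `n = 1, Δ = 0`,
or `n = 2, Δ = 1`, or `2 ≤ Δ < n`): each vertex other than `0` is joined to its parent. -/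
def volkmannTree (n Δ : ℕ) : SimpleGraph (Fin n) :=
  SimpleGraph.fromRel fun i j => 0 < j.val ∧ i.val = volkmannParent Δ j.val

instance volkmannTree.decidableAdj (n Δ : ℕ) : DecidableRel (volkmannTree n Δ).Adj :=
  inferInstanceAs (DecidableRel (SimpleGraph.fromRel
    fun i j : Fin n => 0 < j.val ∧ i.val = volkmannParent Δ j.val).Adj)

/-! Put `d = max (Δ - 1) 1`. Every tree in question embeds into the infinite `(d + 1)`-regular tree
(`SimpleGraph.IsTree.exists_regularTree_embedding`), whose vertices are numbered by ℕ in
breadth-first order so that the Volkmann tree is induced on the initial segment `{0, …, n - 1}`.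
Spectral moments count closed walks, so it suffices that, among the `n`-element vertex sets `S` of
the regular tree, the initial segment maximizes closed walks of each positive length
(`finsetMoment_le_range`).

If `S` is not an initial segment, choose `x < y` with `x ∉ S` and `y ∈ S`. The path from `x` to `y`
has a midpoint, a vertex or an edge. The branches hanging there on the two sides are isomorphic,
with `x` corresponding to `y`, and every label on the side of `x` is smaller than its mirror image
(`exists_regReach`, `regWalk_lt_regWalk`). Polarization pushes each element of `S` on the far side
to its mirror image when that is free. It keeps the cardinality and lowers the sum of labels, so
repeating it ends at the initial segment.

Polarization loses no closed walks. It replaces the two traces of `S` on the branches by their union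
and intersection. Entries of the branch matrices form supermodular quadruples, a property stable
under sums and products, so the claim holds while the branches are disconnected from the rest. The
connection at the midpoint is then switched on by a parameter `t`, and the derivatives in `t` are
compared (`trace_pow_add_le`) coefficientwise through formal resolvents. For a midpoint vertex they
depend monotonically on a weighted sum of the root entries of the branch resolvents
(`trace_pow_le_of_vertex`). For a midpoint edge they depend on the product of these entries, which
is handled by first-return series (`coeffNonneg_resolvent_mul_sub`, `trace_pow_le_of_edge`).

The Estrada index is the sum of all moments with weights `1 / k!`, hence inherits the inequality. -/

open Matrix PowerSeries in
/-- The resolvent `(1 - zA)⁻¹ = ∑ zᵏ Aᵏ` of a real matrix, as a matrix of formal power series. -/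
noncomputable def resolventSeries {ι : Type*} [Fintype ι] [DecidableEq ι] (A : Matrix ι ι ℝ) :
    Matrix ι ι (PowerSeries ℝ) :=
  Matrix.of fun i j => PowerSeries.mk fun k => (A ^ k) i j

/-- All coefficients of a real power series are nonnegative. -/
def CoeffNonneg (f : PowerSeries ℝ) : Prop := ∀ n, 0 ≤ PowerSeries.coeff n f

/-! ### Coefficientwise positivity of power series. -/

namespace CoeffNonneg

open PowerSeries

theorem add {f g : PowerSeries ℝ} (hf : CoeffNonneg f) (hg : CoeffNonneg g) :
    CoeffNonneg (f + g) := fun n => by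
  simpa using add_nonneg (hf n) (hg n)

theorem mul {f g : PowerSeries ℝ} (hf : CoeffNonneg f) (hg : CoeffNonneg g) :
    CoeffNonneg (f * g) := fun n => by
  rw [coeff_mul]
  exact Finset.sum_nonneg fun p _ => mul_nonneg (hf _) (hg _)

theorem C {a : ℝ} (ha : 0 ≤ a) : CoeffNonneg (PowerSeries.C a) := fun n => by
  rw [coeff_C]; split_ifs <;> simp [ha]

theorem X : CoeffNonneg (PowerSeries.X : PowerSeries ℝ) := fun n => by
  rw [coeff_X]; split_ifs <;> simp

/-- The equation reads `r = g + X u r`, which computes each coefficient of `r` from earlier ones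
without subtraction. -/
theorem of_X_mul_self {u g r : PowerSeries ℝ} (hu : CoeffNonneg u) (hg : CoeffNonneg g)
    (h : (1 - PowerSeries.X * u) * r = g) : CoeffNonneg r := by
  have hr : r = g + PowerSeries.X * (u * r) := by linear_combination h
  intro n
  induction n using Nat.strong_induction_on with
  | _ n ih =>
    rw [hr, map_add]
    refine add_nonneg (hg n) ?_
    cases n with
    | zero => simp
    | succ n =>
      rw [coeff_succ_X_mul, coeff_mul]
      refine Finset.sum_nonneg fun p hp => mul_nonneg (hu _) (ih _ ?_)
      have := Finset.HasAntidiagonal.mem_antidiagonal.1 hp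
      omega

/-- Solutions of `(1 - Xu) r = g` are coefficientwise monotone in `u`. -/
theorem sub_of_X_mul_self {u u' g r r' : PowerSeries ℝ} (hu : CoeffNonneg u)
    (hu' : CoeffNonneg (u' - u)) (hg : CoeffNonneg g)
    (h : (1 - PowerSeries.X * u) * r = g) (h' : (1 - PowerSeries.X * u') * r' = g) :
    CoeffNonneg (r' - r) := by
  have hr := of_X_mul_self hu hg h
  have hu2 : CoeffNonneg u' := by simpa using hu.add hu'
  refine of_X_mul_self hu2 (CoeffNonneg.X.mul (hu'.mul hr)) (r := r' - r) ?_
  linear_combination h' - h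

end CoeffNonneg

/-! ### Formal resolvents and derivatives of traces. -/

section Resolvent

open Matrix PowerSeries

variable {ι : Type*} [Fintype ι] [DecidableEq ι]

@[simp] theorem coeff_resolvent (A : Matrix ι ι ℝ) (i j : ι) (n : ℕ) :
    coeff n (resolventSeries A i j) = (A ^ n) i j := by simp [resolventSeries]

theorem one_sub_X_smul_mul_resolvent (A : Matrix ι ι ℝ) :
    (1 - (X : PowerSeries ℝ) • A.map C) * resolventSeries A = 1 := by
  rw [sub_mul, one_mul, sub_eq_iff_eq_add, smul_mul]
  ext i j n
  cases n with
  | zero => simp [Matrix.one_apply]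
  | succ n =>
    have h1 : coeff (n + 1) ((1 : Matrix ι ι (PowerSeries ℝ)) i j) = 0 := by
      rw [Matrix.one_apply]; split_ifs <;> simp [coeff_one]
    simp [h1, coeff_succ_X_mul, Matrix.mul_apply, pow_succ']

theorem resolvent_mul_one_sub_X_smul (A : Matrix ι ι ℝ) :
    resolventSeries A * (1 - (X : PowerSeries ℝ) • A.map C) = 1 :=
  mul_eq_one_comm.1 (one_sub_X_smul_mul_resolvent A)

/-- The second resolvent identity: a walk either uses only `A` or splits at its first step taken
from `D`. -/
theorem resolvent_add (A D : Matrix ι ι ℝ) :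
    resolventSeries (A + D) =
      resolventSeries A + (X : PowerSeries ℝ) • (resolventSeries A * D.map C * resolventSeries (A + D)) := by
  have h1 := resolvent_mul_one_sub_X_smul A
  have h2 := one_sub_X_smul_mul_resolvent (A + D)
  have h3 : (1 - (X : PowerSeries ℝ) • A.map C) =
      (1 - (X : PowerSeries ℝ) • (A + D).map C) + (X : PowerSeries ℝ) • D.map C := by
    rw [Matrix.map_add _ (by simp), smul_add]; abel
  calc resolventSeries (A + D)
      = resolventSeries A * (1 - (X : PowerSeries ℝ) • A.map C) * resolventSeries (A + D) := by
        rw [h1, one_mul]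
    _ = _ := by
        rw [h3, mul_add, add_mul, mul_assoc, h2, mul_one, Matrix.mul_smul, Matrix.smul_mul]

theorem coeffNonneg_resolvent {A : Matrix ι ι ℝ} (hA : ∀ i j, 0 ≤ A i j) (i j : ι) :
    CoeffNonneg (resolventSeries A i j) := by
  intro n
  rw [coeff_resolvent]
  induction n generalizing i j with
  | zero => rw [pow_zero, Matrix.one_apply]; split_ifs <;> simp
  | succ n ih =>
    rw [pow_succ, Matrix.mul_apply]
    exact Finset.sum_nonneg fun l _ => mul_nonneg (ih i l) (hA l j)

theorem resolvent_symm {A : Matrix ι ι ℝ} (hA : A.IsSymm) (i j : ι) :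
    resolventSeries A i j = resolventSeries A j i := by
  ext n
  rw [coeff_resolvent, coeff_resolvent]
  conv_lhs => rw [← hA.eq, ← Matrix.transpose_pow, Matrix.transpose_apply]

/-- The matrix of an edge joining `i` and `j`. -/
def coupling (i j : ι) : Matrix ι ι ℝ := single i j 1 + single j i 1

theorem coupling_isSymm {ι : Type*} [DecidableEq ι] (i j : ι) : (coupling i j).IsSymm := by
  simp [Matrix.IsSymm, coupling, add_comm]

theorem trace_coupling_mul (i j : ι) (P : Matrix ι ι ℝ) :
    (coupling i j * P).trace = P j i + P i j := by
  simp [coupling, add_mul, Matrix.trace_add, Matrix.trace_single_mul]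

theorem mul_smul_coupling_mul_apply (a : ℝ) (i j : ι) (M N : Matrix ι ι (PowerSeries ℝ)) (k l : ι) :
    (M * (a • coupling i j).map C * N) k l = C a * (M k i * N j l + M k j * N i l) := by
  have h : (a • coupling i j).map (C (R := ℝ)) = single i j (C a) + single j i (C a) := by
    have hs : ∀ x y : ι, (single x y a).map (C (R := ℝ)) = single x y (C a) := fun x y => by
      ext p q : 2
      simp only [Matrix.map_apply, Matrix.single, Matrix.of_apply]
      split_ifs <;> simp
    rw [coupling, smul_add, smul_single, smul_single, Matrix.map_add _ (map_add C)]
    simp only [smul_eq_mul, mul_one, hs]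
  rw [h, mul_add, add_mul]
  simp only [Matrix.add_apply, Matrix.mul_apply, Matrix.single, Matrix.of_apply, mul_ite, mul_zero,
    ite_and]
  simp [Finset.sum_ite_eq, ite_mul]
  ring

/-- The derivative of the entries of `(A + tD) ^ k`. -/
theorem hasDerivAt_pow_apply (A D : Matrix ι ι ℝ) (k : ℕ) (t : ℝ) (i j : ι) :
    HasDerivAt (fun t : ℝ => ((A + t • D) ^ k) i j)
      ((∑ m ∈ Finset.range k, (A + t • D) ^ m * D * (A + t • D) ^ (k - 1 - m)) i j) t := by
  induction k generalizing i j with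
  | zero => simpa using hasDerivAt_const t ((1 : Matrix ι ι ℝ) i j)
  | succ k ih =>
    have h1 : ∀ l, HasDerivAt (fun t : ℝ => (A + t • D) l j) (D l j) t := fun l => by
      simpa using ((hasDerivAt_id t).mul_const (D l j)).const_add (A l j)
    have h2 := HasDerivAt.fun_sum (u := Finset.univ) fun l _ => (ih i l).mul (h1 l)
    simp only [pow_succ, Matrix.mul_apply]
    refine h2.congr_deriv ((Finset.sum_add_distrib (s := Finset.univ)
      (f := fun l => (∑ m ∈ Finset.range k,
        (A + t • D) ^ m * D * (A + t • D) ^ (k - 1 - m)) i l * (A + t • D) l j)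
      (g := fun l => ((A + t • D) ^ k) i l * D l j)).trans ?_)
    change ((∑ m ∈ Finset.range k, (A + t • D) ^ m * D * (A + t • D) ^ (k - 1 - m)) *
      (A + t • D)) i j + ((A + t • D) ^ k * D) i j = _
    rw [Finset.sum_range_succ, Finset.sum_mul, Matrix.add_apply]
    refine congrArg₂ (· + ·) (congrFun (congrFun ?_ i) j) ?_
    · refine Finset.sum_congr rfl fun m hm => ?_
      have : k + 1 - 1 - m = (k - 1 - m) + 1 := by have := Finset.mem_range.1 hm; omega
      rw [this, pow_succ (n := k - 1 - m), ← mul_assoc]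
    · simp

/-- Under the trace, cyclicity makes the `k` terms of the noncommutative product rule equal. -/
theorem hasDerivAt_trace_pow (A D : Matrix ι ι ℝ) (k : ℕ) (t : ℝ) :
    HasDerivAt (fun t : ℝ => ((A + t • D) ^ k).trace)
      (k * (D * (A + t • D) ^ (k - 1)).trace) t := by
  have h := HasDerivAt.fun_sum (u := Finset.univ) fun i _ => hasDerivAt_pow_apply A D k t i i
  refine (by simpa [Matrix.trace] using h : HasDerivAt _ _ t).congr_deriv ?_
  change (∑ m ∈ Finset.range k, (A + t • D) ^ m * D * (A + t • D) ^ (k - 1 - m)).trace = _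
  rw [Matrix.trace_sum, Finset.sum_congr rfl (g := fun _ => (D * (A + t • D) ^ (k - 1)).trace)]
  · simp
  · intro m hm
    rw [mul_assoc, Matrix.trace_mul_comm, mul_assoc, ← pow_add]
    congr 3
    have := Finset.mem_range.1 hm; omega

/-- The difference of the two traces along `A + tD` and `A' + tD'` has nonnegative derivative, so
its sign at `t = 0` persists to `t = 1`. This reduces a comparison of closed walks to one of walks
marked at a coupling edge. -/
theorem trace_pow_add_le {A D A' D' : Matrix ι ι ℝ} {k : ℕ}
    (h0 : (A ^ k).trace ≤ (A' ^ k).trace)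
    (h : ∀ t : ℝ, 0 ≤ t → ∀ m : ℕ,
      (D * (A + t • D) ^ m).trace ≤ (D' * (A' + t • D') ^ m).trace) :
    ((A + D) ^ k).trace ≤ ((A' + D') ^ k).trace := by
  have hd : ∀ t, HasDerivAt
      (fun t : ℝ => ((A' + t • D') ^ k).trace - ((A + t • D) ^ k).trace)
      (k * (D' * (A' + t • D') ^ (k - 1)).trace - k * (D * (A + t • D) ^ (k - 1)).trace) t :=
    fun t => (hasDerivAt_trace_pow A' D' k t).sub (hasDerivAt_trace_pow A D k t)
  have hm := monotoneOn_of_deriv_nonneg (convex_Ici (0 : ℝ))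
    (fun t _ => (hd t).continuousAt.continuousWithinAt)
    (fun t _ => (hd t).differentiableAt.differentiableWithinAt)
    (fun t ht => by
      rw [interior_Ici] at ht
      rw [(hd t).deriv, ← mul_sub]
      exact mul_nonneg (Nat.cast_nonneg k) (sub_nonneg.2 (h t (le_of_lt ht) _)))
  have := hm (Set.mem_Ici.2 le_rfl) (Set.mem_Ici.2 zero_le_one) zero_le_one
  simp at this
  linarith

end Resolvent

/-! ### Supermodular quadruples of numbers and matrices. -/

/-- A quadruple `y ≤ a, b ≤ x` of nonnegative reals with `a + b ≤ x + y`: the values of a monotone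
supermodular function at `L ∩ R`, `L`, `R`, `L ∪ R`. -/
structure Supermod (y a b x : ℝ) : Prop where
  nonneg : 0 ≤ y
  le_left : y ≤ a
  le_right : y ≤ b
  add_le : a + b ≤ x + y

namespace Supermod

variable {y a b x y' a' b' x' : ℝ}

theorem mul (h : Supermod y a b x) (h' : Supermod y' a' b' x') :
    Supermod (y * y') (a * a') (b * b') (x * x') where
  nonneg := mul_nonneg h.nonneg h'.nonneg
  le_left := mul_le_mul h.le_left h'.le_left h'.nonneg (h.nonneg.trans h.le_left)
  le_right := mul_le_mul h.le_right h'.le_right h'.nonneg (h.nonneg.trans h.le_right)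
  add_le := by
    have hx' : 0 ≤ x' := by linarith [h'.nonneg, h'.le_left, h'.le_right, h'.add_le]
    -- The defect `xx' + yy' - aa' - bb'` is the sum of the four products `h1`, …, `h4`.
    have h1 := mul_nonneg (sub_nonneg.2 h.add_le) hx'
    have h2 := mul_nonneg (sub_nonneg.2 h.le_left)
      (by linarith [h'.le_right, h'.add_le] : 0 ≤ x' - a')
    have h3 := mul_nonneg (sub_nonneg.2 h.le_right)
      (by linarith [h'.le_left, h'.add_le] : 0 ≤ x' - b')
    have h4 := mul_nonneg h.nonneg (sub_nonneg.2 h'.add_le)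
    linarith

theorem add (h : Supermod y a b x) (h' : Supermod y' a' b' x') :
    Supermod (y + y') (a + a') (b + b') (x + x') where
  nonneg := add_nonneg h.nonneg h'.nonneg
  le_left := add_le_add h.le_left h'.le_left
  le_right := add_le_add h.le_right h'.le_right
  add_le := by linarith [h.add_le, h'.add_le]

theorem const {r : ℝ} (hr : 0 ≤ r) : Supermod r r r r := ⟨hr, le_rfl, le_rfl, le_rfl⟩

theorem sum {ι : Type*} (s : Finset ι) {y a b x : ι → ℝ}
    (h : ∀ i, Supermod (y i) (a i) (b i) (x i)) :
    Supermod (∑ i ∈ s, y i) (∑ i ∈ s, a i) (∑ i ∈ s, b i) (∑ i ∈ s, x i) := by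
  classical
  induction s using Finset.induction_on with
  | empty => simpa using const le_rfl
  | insert i s hi ih => simpa [Finset.sum_insert hi] using (h i).add ih

theorem left_nonneg (h : Supermod y a b x) : 0 ≤ a := h.nonneg.trans h.le_left

theorem right_nonneg (h : Supermod y a b x) : 0 ≤ b := h.nonneg.trans h.le_right

theorem left_le (h : Supermod y a b x) : a ≤ x := by linarith [h.le_right, h.add_le]

theorem right_le (h : Supermod y a b x) : b ≤ x := by linarith [h.le_left, h.add_le]

theorem top_nonneg (h : Supermod y a b x) : 0 ≤ x := h.left_nonneg.trans h.left_le

end Supermod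

section SupermodMatrix

open Matrix PowerSeries

variable {H : Type*} [Fintype H] [DecidableEq H] {my ma mb mx : Matrix H H ℝ}

theorem Supermod.matrix_pow (h : ∀ i j, Supermod (my i j) (ma i j) (mb i j) (mx i j)) (k : ℕ)
    (i j : H) : Supermod ((my ^ k) i j) ((ma ^ k) i j) ((mb ^ k) i j) ((mx ^ k) i j) := by
  induction k generalizing i j with
  | zero =>
    simp only [pow_zero, Matrix.one_apply]
    split_ifs
    · exact Supermod.const zero_le_one
    · exact Supermod.const le_rfl
  | succ k ih =>
    simp only [pow_succ, Matrix.mul_apply]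
    exact Supermod.sum _ fun l => (ih i l).mul (h l j)

theorem Supermod.trace_pow (h : ∀ i j, Supermod (my i j) (ma i j) (mb i j) (mx i j)) (k : ℕ) :
    Supermod (my ^ k).trace (ma ^ k).trace (mb ^ k).trace (mx ^ k).trace :=
  Supermod.sum _ fun i => Supermod.matrix_pow h k i i

end SupermodMatrix

/-! ### Merging two branches, in matrix form. -/

section Coupling

open Matrix PowerSeries

variable {ι : Type*} [Fintype ι] [DecidableEq ι]

theorem Matrix.IsSymm.pow' {A : Matrix ι ι ℝ} (hA : A.IsSymm) (m : ℕ) (i j : ι) :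
    (A ^ m) i j = (A ^ m) j i := by
  conv_lhs => rw [← hA.eq, ← Matrix.transpose_pow, Matrix.transpose_apply]

/-- Resolvent entries after joining `i₀` to `i₁` and `i₂`, which lie in three different
components. -/
theorem resolvent_add_two_couplings {A : Matrix ι ι ℝ} {i₀ i₁ i₂ : ι} (α β t : ℝ)
    (h01 : resolventSeries A i₀ i₁ = 0) (h10 : resolventSeries A i₁ i₀ = 0)
    (h02 : resolventSeries A i₀ i₂ = 0) (h20 : resolventSeries A i₂ i₀ = 0)
    (h12 : resolventSeries A i₁ i₂ = 0) (h21 : resolventSeries A i₂ i₁ = 0) :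
    let ρ := resolventSeries (A + t • (α • coupling i₀ i₁ + β • coupling i₀ i₂))
    let s := C (α ^ 2) * resolventSeries A i₁ i₁ + C (β ^ 2) * resolventSeries A i₂ i₂
    C α * ρ i₁ i₀ + C β * ρ i₂ i₀ = X * (C t * (s * ρ i₀ i₀)) ∧
      (1 - X * (X * (C (t ^ 2) * (resolventSeries A i₀ i₀ * s)))) * ρ i₀ i₀ =
        resolventSeries A i₀ i₀ := by
  intro ρ s
  have hρ : ∀ i j, ρ i j = resolventSeries A i j + X *
      (C (t * α) * (resolventSeries A i i₀ * ρ i₁ j + resolventSeries A i i₁ * ρ i₀ j) +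
        C (t * β) * (resolventSeries A i i₀ * ρ i₂ j + resolventSeries A i i₂ * ρ i₀ j)) :=
    fun i j => by
      have hE : t • (α • coupling i₀ i₁ + β • coupling i₀ i₂) =
          (t * α) • coupling i₀ i₁ + (t * β) • coupling i₀ i₂ := by simp [smul_add, smul_smul]
      have := congrFun (congrFun (resolvent_add A
        (t • (α • coupling i₀ i₁ + β • coupling i₀ i₂))) i) j
      simp only [ρ]
      rw [this, Matrix.add_apply, Matrix.smul_apply, smul_eq_mul, hE,
        Matrix.map_add _ (map_add C), mul_add, add_mul, Matrix.add_apply,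
        mul_smul_coupling_mul_apply, mul_smul_coupling_mul_apply]
  have e1 := hρ i₁ i₀
  have e2 := hρ i₂ i₀
  have e0 := hρ i₀ i₀
  simp only [h01, h10, h02, h20, h12, h21, zero_mul, zero_add, add_zero, mul_zero, map_mul]
    at e0 e1 e2
  have hs : C α * ρ i₁ i₀ + C β * ρ i₂ i₀ = X * (C t * (s * ρ i₀ i₀)) := by
    simp only [s, map_pow]
    linear_combination C α * e1 + C β * e2
  refine ⟨hs, ?_⟩
  rw [map_pow]
  linear_combination e0 + X * resolventSeries A i₀ i₀ * C t * hs

/-- Resolvent entries after joining `i₁` and `i₂`, which lie in different components. -/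
theorem resolvent_add_coupling {A : Matrix ι ι ℝ} {i₁ i₂ : ι} (t : ℝ)
    (h12 : resolventSeries A i₁ i₂ = 0) (h21 : resolventSeries A i₂ i₁ = 0) :
    (1 - X * (X * (C (t ^ 2) * (resolventSeries A i₁ i₁ * resolventSeries A i₂ i₂)))) *
        resolventSeries (A + t • coupling i₁ i₂) i₂ i₁ =
      X * (C t * (resolventSeries A i₁ i₁ * resolventSeries A i₂ i₂)) := by
  set ρ := resolventSeries (A + t • coupling i₁ i₂) with hρ'
  have hρ : ∀ i j, ρ i j = resolventSeries A i j + X *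
      (C t * (resolventSeries A i i₁ * ρ i₂ j + resolventSeries A i i₂ * ρ i₁ j)) := fun i j => by
    conv_lhs => rw [hρ', resolvent_add A _]
    rw [Matrix.add_apply, Matrix.smul_apply, smul_eq_mul, mul_smul_coupling_mul_apply]
  have e1 := hρ i₁ i₁
  have e2 := hρ i₂ i₁
  simp only [h12, h21, zero_mul, zero_add, add_zero] at e1 e2
  rw [map_pow]
  linear_combination e2 + X * C t * resolventSeries A i₂ i₂ * e1

variable {F H : Type*} [Fintype F] [DecidableEq F] [Fintype H] [DecidableEq H]

theorem resolvent_fromBlocks_diagonal (A : Matrix F F ℝ) (B : Matrix H H ℝ) :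
    resolventSeries (fromBlocks A 0 0 B) =
      fromBlocks (resolventSeries A) 0 0 (resolventSeries B) := by
  ext i j n
  rw [coeff_resolvent, fromBlocks_diagonal_pow]
  rcases i with i | i <;> rcases j with j | j <;> simp

/-- The block diagonal matrix of a graph with three parts and no edges between them. -/
def threeBlocks {F H : Type*} (A : Matrix F F ℝ) (B B' : Matrix H H ℝ) : Matrix (F ⊕ (H ⊕ H)) (F ⊕ (H ⊕ H)) ℝ :=
  fromBlocks A 0 0 (fromBlocks B 0 0 B')

theorem threeBlocks_isSymm {F H : Type*} {A : Matrix F F ℝ} {B B' : Matrix H H ℝ} (hA : A.IsSymm)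
    (hB : B.IsSymm) (hB' : B'.IsSymm) : (threeBlocks A B B').IsSymm := by
  simp [threeBlocks, Matrix.IsSymm, fromBlocks_transpose, hA.eq, hB.eq, hB'.eq]

theorem trace_threeBlocks_pow (A : Matrix F F ℝ) (B B' : Matrix H H ℝ) (k : ℕ) :
    (threeBlocks A B B' ^ k).trace = (A ^ k).trace + ((B ^ k).trace + (B' ^ k).trace) := by
  rw [threeBlocks, fromBlocks_diagonal_pow, fromBlocks_diagonal_pow]
  simp [Matrix.trace]

theorem resolvent_threeBlocks (A : Matrix F F ℝ) (B B' : Matrix H H ℝ) :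
    resolventSeries (threeBlocks A B B') = fromBlocks (resolventSeries A) 0 0
      (fromBlocks (resolventSeries B) 0 0 (resolventSeries B')) := by
  rw [threeBlocks, resolvent_fromBlocks_diagonal, resolvent_fromBlocks_diagonal]

theorem coeffNonneg_of_supermod {y a b x : PowerSeries ℝ}
    (h : ∀ n, Supermod (coeff n y) (coeff n a) (coeff n b) (coeff n x)) :
    CoeffNonneg y ∧ CoeffNonneg (a - y) ∧ CoeffNonneg (b - y) ∧ CoeffNonneg (x + y - a - b) := by
  refine ⟨fun n => (h n).nonneg, fun n => ?_, fun n => ?_, fun n => ?_⟩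
  · simpa using (h n).le_left
  · simpa using (h n).le_right
  · have := (h n).add_le
    simp only [map_sub, map_add]; linarith

/-- Merging two branches attached to a common vertex does not decrease the spectral moments. -/
theorem trace_pow_le_of_vertex {A : Matrix F F ℝ} (hA : ∀ i j, 0 ≤ A i j) (hAs : A.IsSymm)
    {my ma mb mx : Matrix H H ℝ} (hm : ∀ i j, Supermod (my i j) (ma i j) (mb i j) (mx i j))
    (hys : my.IsSymm) (has : ma.IsSymm) (hbs : mb.IsSymm) (hxs : mx.IsSymm)
    {wy wa wb wx : ℝ} (hw : Supermod wy wa wb wx) (v : F) (c : H) (k : ℕ) :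
    ((threeBlocks A ma mb + (wa • coupling (Sum.inl v) (Sum.inr (Sum.inl c)) +
      wb • coupling (Sum.inl v) (Sum.inr (Sum.inr c)))) ^ k).trace ≤
    ((threeBlocks A mx my + (wx • coupling (Sum.inl v) (Sum.inr (Sum.inl c)) +
      wy • coupling (Sum.inl v) (Sum.inr (Sum.inr c)))) ^ k).trace := by
  -- The derivative of the trace depends on the two branches only through `s = α² R_B(c,c) + β²
  -- R_B'(c,c)`; here `r` counts closed walks at `v`, and each excursion into a branch contributes a
  -- factor containing `s`.
  have htr : ∀ {B B' : Matrix H H ℝ} (_ : B.IsSymm) (_ : B'.IsSymm) (α β t : ℝ) (m : ℕ),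
      let D := α • coupling (ι := F ⊕ (H ⊕ H)) (Sum.inl v) (Sum.inr (Sum.inl c)) +
        β • coupling (Sum.inl v) (Sum.inr (Sum.inr c))
      ∃ r : PowerSeries ℝ, (D * (threeBlocks A B B' + t • D) ^ m).trace =
        2 * coeff m (X * (C t * ((C (α ^ 2) * resolventSeries B c c +
          C (β ^ 2) * resolventSeries B' c c) * r))) ∧
        (1 - X * (X * (C (t ^ 2) * (resolventSeries A v v * (C (α ^ 2) * resolventSeries B c c +
          C (β ^ 2) * resolventSeries B' c c))))) * r = resolventSeries A v v := by
    intro B B' hB hB' α β t m D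
    have hsymm : (threeBlocks A B B' + t • D).IsSymm :=
      (threeBlocks_isSymm hAs hB hB').add ((((coupling_isSymm _ _).smul _).add
        ((coupling_isSymm _ _).smul _)).smul _)
    have key := resolvent_add_two_couplings (A := threeBlocks A B B') (i₀ := Sum.inl v)
      (i₁ := Sum.inr (Sum.inl c)) (i₂ := Sum.inr (Sum.inr c)) α β t
      (by simp [resolvent_threeBlocks]) (by simp [resolvent_threeBlocks])
      (by simp [resolvent_threeBlocks]) (by simp [resolvent_threeBlocks])
      (by simp [resolvent_threeBlocks]) (by simp [resolvent_threeBlocks])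
    refine ⟨resolventSeries (threeBlocks A B B' + t • D) (Sum.inl v) (Sum.inl v), ?_, ?_⟩
    · have h1 := congrArg (coeff m) key.1
      simp only [map_add, coeff_C_mul, coeff_resolvent] at h1
      simp only [resolvent_threeBlocks, fromBlocks_apply₁₁, fromBlocks_apply₂₂] at h1
      rw [← h1]
      simp only [D, add_mul, Matrix.trace_add, smul_mul, Matrix.trace_smul, trace_coupling_mul,
        smul_eq_mul]
      rw [hsymm.pow' m (Sum.inl v) (Sum.inr (Sum.inl c)),
        hsymm.pow' m (Sum.inl v) (Sum.inr (Sum.inr c))]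
      ring
    · have h2 := key.2
      simp only [resolvent_threeBlocks, fromBlocks_apply₁₁, fromBlocks_apply₂₂] at h2
      exact h2
  refine trace_pow_add_le ?_ fun t ht m => ?_
  · rw [trace_threeBlocks_pow, trace_threeBlocks_pow]
    linarith [(Supermod.trace_pow hm k).add_le]
  · obtain ⟨r, hr, hr'⟩ := htr has hbs wa wb t m
    obtain ⟨r', hr1, hr1'⟩ := htr hxs hys wx wy t m
    rw [hr, hr1]
    set s := C (wa ^ 2) * resolventSeries ma c c + C (wb ^ 2) * resolventSeries mb c c with hs
    set s' := C (wx ^ 2) * resolventSeries mx c c + C (wy ^ 2) * resolventSeries my c c with hs'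
    have hG : CoeffNonneg (resolventSeries A v v) := coeffNonneg_resolvent hA v v
    have hC : CoeffNonneg (C t) := CoeffNonneg.C ht
    have hC2 : CoeffNonneg (C (t ^ 2)) := CoeffNonneg.C (sq_nonneg t)
    have hsn : CoeffNonneg s :=
      ((CoeffNonneg.C (sq_nonneg _)).mul
        (coeffNonneg_resolvent (fun i j => (hm i j).left_nonneg) c c)).add
      ((CoeffNonneg.C (sq_nonneg _)).mul
        (coeffNonneg_resolvent (fun i j => (hm i j).right_nonneg) c c))
    -- Squared weights times walk counts are again supermodular, so `s` grows under merging.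
    have hss : CoeffNonneg (s' - s) := fun n => by
      have := ((hw.mul hw).mul (Supermod.matrix_pow hm n c c)).add_le
      simp only [hs, hs', map_sub, map_add, coeff_C_mul, coeff_resolvent, pow_two]
      linarith
    have hrn : CoeffNonneg r := CoeffNonneg.of_X_mul_self
      (CoeffNonneg.X.mul (hC2.mul (hG.mul hsn))) hG hr'
    have hrr : CoeffNonneg (r' - r) := CoeffNonneg.sub_of_X_mul_self
      (CoeffNonneg.X.mul (hC2.mul (hG.mul hsn)))
      (by
        have := CoeffNonneg.X.mul (hC2.mul (hG.mul hss))
        rwa [show X * (C (t ^ 2) * (resolventSeries A v v * (s' - s))) =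
          X * (C (t ^ 2) * (resolventSeries A v v * s')) -
            X * (C (t ^ 2) * (resolventSeries A v v * s)) by ring] at this) hG hr' hr1'
    have hs'n : CoeffNonneg s' := by simpa using hsn.add hss
    have := (CoeffNonneg.X.mul (hC.mul ((hs'n.mul hrr).add (hss.mul hrn)))) m
    rw [show X * (C t * (s' * (r' - r) + (s' - s) * r)) =
      X * (C t * (s' * r')) - X * (C t * (s * r)) by ring, map_sub] at this
    linarith

/-- The diagonal entry at `c` of the resolvent is `1 / (1 - X² F)`, where `F` counts the walks
from neighbours to neighbours of `c` that avoid `c`. -/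
theorem one_sub_firstReturn_mul_resolvent {B : Matrix H H ℝ} (hB : B.IsSymm) (c : H)
    (hc : B c c = 0) :
    (1 - X * (X * ∑ i, ∑ j, C (B i c * B j c) *
        resolventSeries (Matrix.of fun i j => if i = c ∨ j = c then 0 else B i j) i j)) *
      resolventSeries B c c = 1 := by
  set B₀ : Matrix H H ℝ := Matrix.of fun i j => if i = c ∨ j = c then 0 else B i j with hB₀
  set D : Matrix H H ℝ := B - B₀ with hD
  have hBD : B₀ + D = B := by simp [hD]
  have hDc : ∀ i, D i c = B i c := fun i => by simp [hD, hB₀]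
  have hDc' : ∀ i, D c i = B i c := fun i => by simp [hD, hB₀, hB.apply]
  have hD0 : ∀ i j, i ≠ c → j ≠ c → D i j = 0 := fun i j hi hj => by simp [hD, hB₀, hi, hj]
  have hρ : ∀ i j, resolventSeries B i j = resolventSeries B₀ i j + X *
      ∑ l, (∑ m, resolventSeries B₀ i m * C (D m l)) * resolventSeries B l j := fun i j => by
    conv_lhs => rw [← hBD, resolvent_add B₀ D, hBD]
    simp [Matrix.mul_apply]
  -- In `B₀` the vertex `c` is isolated.
  have hcol : ∀ i, resolventSeries B₀ i c = if i = c then 1 else 0 := fun i => by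
    ext n
    rw [coeff_resolvent]
    cases n with
    | zero => by_cases h : i = c <;> simp [h]
    | succ n =>
      rw [pow_succ, Matrix.mul_apply, Finset.sum_eq_zero]
      · split_ifs <;> simp [coeff_one]
      · intro l _; simp [hB₀]
  have hrow : ∀ j, resolventSeries B₀ c j = if j = c then 1 else 0 := fun j => by
    rw [resolvent_symm, hcol]
    ext x y; simp [hB₀, hB.apply, or_comm]
  -- Split a walk from `i` to `c` at its first arrival at `c`.
  have hi : ∀ i, i ≠ c → resolventSeries B i c =
      X * ((∑ m, resolventSeries B₀ i m * C (B m c)) * resolventSeries B c c) := fun i hic => by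
    rw [hρ i c, hcol, if_neg hic, zero_add, Finset.sum_eq_single c]
    · simp only [hDc]
    · intro l _ hl
      rw [Finset.sum_eq_zero, zero_mul]
      intro m _
      by_cases hm : m = c
      · rw [hm, hcol, if_neg hic, zero_mul]
      · rw [hD0 m l hm hl, map_zero, mul_zero]
    · simp
  have hcc : resolventSeries B c c = 1 + X * ∑ l, C (B l c) * resolventSeries B l c := by
    conv_lhs => rw [hρ c c]
    simp only [hrow, if_pos, ite_mul, one_mul, zero_mul, Finset.sum_ite_eq', Finset.mem_univ, hDc']
  have hsum : ∑ l, C (B l c) * resolventSeries B l c =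
      X * (∑ i, ∑ j, C (B i c * B j c) * resolventSeries B₀ i j) * resolventSeries B c c := by
    rw [Finset.mul_sum, Finset.sum_mul]
    refine Finset.sum_congr rfl fun i _ => ?_
    by_cases hic : i = c
    · simp [hic, hc]
    · rw [hi i hic, Finset.sum_mul, Finset.mul_sum, Finset.mul_sum, Finset.mul_sum, Finset.sum_mul]
      refine Finset.sum_congr rfl fun j _ => ?_
      rw [map_mul]; ring
  linear_combination hcc + X * hsum

/-- Closed walks at the roots of two branches, against those of their union and intersection. -/
theorem coeffNonneg_resolvent_mul_sub {my ma mb mx : Matrix H H ℝ}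
    (hm : ∀ i j, Supermod (my i j) (ma i j) (mb i j) (mx i j))
    (hys : my.IsSymm) (has : ma.IsSymm) (hbs : mb.IsSymm) (hxs : mx.IsSymm) (c : H)
    (hc : mx c c = 0) :
    CoeffNonneg (resolventSeries mx c c * resolventSeries my c c -
      resolventSeries ma c c * resolventSeries mb c c) := by
  have hac : ma c c = 0 := le_antisymm (hc ▸ (hm c c).left_le) (hm c c).left_nonneg
  have hbc : mb c c = 0 := le_antisymm (hc ▸ (hm c c).right_le) (hm c c).right_nonneg
  have hyc : my c c = 0 := le_antisymm (hac ▸ (hm c c).le_left) (hm c c).nonneg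
  have hx := one_sub_firstReturn_mul_resolvent hxs c hc
  have hy := one_sub_firstReturn_mul_resolvent hys c hyc
  have ha := one_sub_firstReturn_mul_resolvent has c hac
  have hb := one_sub_firstReturn_mul_resolvent hbs c hbc
  have hm0 : ∀ i j, Supermod
      ((Matrix.of fun i j => if i = c ∨ j = c then 0 else my i j : Matrix H H ℝ) i j)
      ((Matrix.of fun i j => if i = c ∨ j = c then 0 else ma i j : Matrix H H ℝ) i j)
      ((Matrix.of fun i j => if i = c ∨ j = c then 0 else mb i j : Matrix H H ℝ) i j)
      ((Matrix.of fun i j => if i = c ∨ j = c then 0 else mx i j : Matrix H H ℝ) i j) := by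
    intro i j
    simp only [Matrix.of_apply]
    split_ifs
    · exact Supermod.const le_rfl
    · exact hm i j
  obtain ⟨n1, n2, n3, n4⟩ := coeffNonneg_of_supermod
    (y := ∑ i, ∑ j, C (my i c * my j c) *
        resolventSeries (Matrix.of fun i j => if i = c ∨ j = c then 0 else my i j) i j)
    (a := ∑ i, ∑ j, C (ma i c * ma j c) *
        resolventSeries (Matrix.of fun i j => if i = c ∨ j = c then 0 else ma i j) i j)
    (b := ∑ i, ∑ j, C (mb i c * mb j c) *
        resolventSeries (Matrix.of fun i j => if i = c ∨ j = c then 0 else mb i j) i j)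
    (x := ∑ i, ∑ j, C (mx i c * mx j c) *
        resolventSeries (Matrix.of fun i j => if i = c ∨ j = c then 0 else mx i j) i j)
    (fun n => by
      simp only [map_sum, coeff_C_mul, coeff_resolvent]
      exact Supermod.sum _ fun i => Supermod.sum _ fun j =>
        ((hm i c).mul (hm j c)).mul (Supermod.matrix_pow hm0 n i j))
  set Gx := resolventSeries mx c c
  set Gy := resolventSeries my c c
  set Ga := resolventSeries ma c c
  set Gb := resolventSeries mb c c
  have gx : CoeffNonneg Gx := coeffNonneg_resolvent (fun i j => (hm i j).top_nonneg) c c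
  have gy : CoeffNonneg Gy := coeffNonneg_resolvent (fun i j => (hm i j).nonneg) c c
  have ga : CoeffNonneg Ga := coeffNonneg_resolvent (fun i j => (hm i j).left_nonneg) c c
  have gb : CoeffNonneg Gb := coeffNonneg_resolvent (fun i j => (hm i j).right_nonneg) c c
  generalize (∑ i, ∑ j, C (mx i c * mx j c) * resolventSeries
    (Matrix.of fun i j => if i = c ∨ j = c then 0 else mx i j) i j) = fx at *
  generalize (∑ i, ∑ j, C (my i c * my j c) * resolventSeries
    (Matrix.of fun i j => if i = c ∨ j = c then 0 else my i j) i j) = fy at *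
  generalize (∑ i, ∑ j, C (ma i c * ma j c) * resolventSeries
    (Matrix.of fun i j => if i = c ∨ j = c then 0 else ma i j) i j) = fa at *
  generalize (∑ i, ∑ j, C (mb i c * mb j c) * resolventSeries
    (Matrix.of fun i j => if i = c ∨ j = c then 0 else mb i j) i j) = fb at *
  have hxa : CoeffNonneg (fx - fa) := by
    have := n4.add n3
    rwa [show fx + fy - fa - fb + (fb - fy) = fx - fa by ring] at this
  have hxb : CoeffNonneg (fx - fb) := by
    have := n4.add n2
    rwa [show fx + fy - fa - fb + (fa - fy) = fx - fb by ring] at this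
  -- Each root entry is `1 / (1 - X² f)`. With `δ = fx + fy - fa - fb`, the difference of the
  -- denominators `(1 - X² fa)(1 - X² fb) - (1 - X² fx)(1 - X² fy)` equals `X² δ (1 - X² fx) + X⁴
  -- (fx - fa)(fx - fb)`. Multiplying by all four resolvent entries gives `e1 + e2`, since `Gx`
  -- cancels `1 - X² fx`.
  have e1 := (CoeffNonneg.X.mul (CoeffNonneg.X.mul (((gy.mul ga).mul gb).mul n4)))
  have e2 := (((gx.mul gy).mul ga).mul gb).mul
    ((CoeffNonneg.X.mul (CoeffNonneg.X.mul hxa)).mul (CoeffNonneg.X.mul (CoeffNonneg.X.mul hxb)))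
  have e3 := e1.add e2
  convert e3 using 1
  linear_combination (-(Gx * Gy * (1 - X * (X * fb)) * Gb)) * ha - Gx * Gy * hb +
    (Ga * Gb * (1 - X * (X * fy)) * Gy + X * (X * (Gy * Ga * Gb * (fx + fy - fa - fb)))) * hx +
    Ga * Gb * hy

/-- Merging the two sides of an edge does not decrease the spectral moments. -/
theorem trace_pow_le_of_edge (A : Matrix F F ℝ)
    {my ma mb mx : Matrix H H ℝ} (hm : ∀ i j, Supermod (my i j) (ma i j) (mb i j) (mx i j))
    (hys : my.IsSymm) (has : ma.IsSymm) (hbs : mb.IsSymm) (hxs : mx.IsSymm)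
    (hAs : A.IsSymm) (c : H) (hc : mx c c = 0) (k : ℕ) :
    ((threeBlocks A ma mb + coupling (Sum.inr (Sum.inl c)) (Sum.inr (Sum.inr c))) ^ k).trace ≤
    ((threeBlocks A mx my + coupling (Sum.inr (Sum.inl c)) (Sum.inr (Sum.inr c))) ^ k).trace := by
  -- Here the derivative depends only on the product of the two root entries.
  have htr : ∀ {B B' : Matrix H H ℝ} (_ : B.IsSymm) (_ : B'.IsSymm) (t : ℝ) (m : ℕ),
      let D := coupling (ι := F ⊕ (H ⊕ H)) (Sum.inr (Sum.inl c)) (Sum.inr (Sum.inr c))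
      ∃ r : PowerSeries ℝ, (D * (threeBlocks A B B' + t • D) ^ m).trace = 2 * coeff m r ∧
        (1 - X * (X * (C (t ^ 2) * (resolventSeries B c c * resolventSeries B' c c)))) * r =
          X * (C t * (resolventSeries B c c * resolventSeries B' c c)) := by
    intro B B' hB hB' t m D
    have hsymm : (threeBlocks A B B' + t • D).IsSymm :=
      (threeBlocks_isSymm hAs hB hB').add ((coupling_isSymm _ _).smul _)
    have key := resolvent_add_coupling (A := threeBlocks A B B')
      (i₁ := Sum.inr (Sum.inl c)) (i₂ := Sum.inr (Sum.inr c)) t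
      (by simp [resolvent_threeBlocks]) (by simp [resolvent_threeBlocks])
    refine ⟨resolventSeries (threeBlocks A B B' + t • D) (Sum.inr (Sum.inr c))
      (Sum.inr (Sum.inl c)), ?_, ?_⟩
    rotate_left
    · simp only [resolvent_threeBlocks, fromBlocks_apply₁₁, fromBlocks_apply₂₂] at key
      exact key
    · rw [coeff_resolvent, trace_coupling_mul,
        hsymm.pow' m (Sum.inr (Sum.inl c)) (Sum.inr (Sum.inr c))]
      ring
  refine trace_pow_add_le ?_ fun t ht m => ?_
  · rw [trace_threeBlocks_pow, trace_threeBlocks_pow]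
    linarith [(Supermod.trace_pow hm k).add_le]
  · obtain ⟨r, hr, hr'⟩ := htr has hbs t m
    obtain ⟨r', hr1, hr1'⟩ := htr hxs hys t m
    rw [hr, hr1]
    have hp := coeffNonneg_resolvent_mul_sub hm hys has hbs hxs c hc
    have hpn := (coeffNonneg_resolvent (fun i j => (hm i j).left_nonneg) c c).mul
      (coeffNonneg_resolvent (fun i j => (hm i j).right_nonneg) c c)
    generalize resolventSeries ma c c * resolventSeries mb c c = p at *
    generalize resolventSeries mx c c * resolventSeries my c c = p' at *
    have hC : CoeffNonneg (C t) := CoeffNonneg.C ht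
    have hC2 : CoeffNonneg (C (t ^ 2)) := CoeffNonneg.C (sq_nonneg t)
    have hp' : CoeffNonneg p' := by simpa using hp.add hpn
    have hrn : CoeffNonneg r := CoeffNonneg.of_X_mul_self
      (CoeffNonneg.X.mul (hC2.mul hpn)) (CoeffNonneg.X.mul (hC.mul hpn)) hr'
    have hrr : CoeffNonneg (r' - r) := by
      refine CoeffNonneg.of_X_mul_self (CoeffNonneg.X.mul (hC2.mul hp'))
        ((CoeffNonneg.X.mul (hC.mul hp)).add
          (CoeffNonneg.X.mul (CoeffNonneg.X.mul (hC2.mul (hp.mul hrn))))) ?_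
      linear_combination hr1' - hr'
    have := hrr m
    rw [map_sub] at this
    linarith

end Coupling

/-! ### Induced subgraphs, branches and polarization. -/

/-- The indicator of a proposition, as a real number. -/
noncomputable def ind (p : Prop) : ℝ := @ite ℝ p (Classical.propDecidable p) 1 0

theorem ind_of_true {p : Prop} (h : p) : ind p = 1 := by simp [ind, h]

theorem ind_of_false {p : Prop} (h : ¬p) : ind p = 0 := by simp [ind, h]

theorem ind_nonneg (p : Prop) : 0 ≤ ind p := by unfold ind; split_ifs <;> simp

theorem ind_supermod (p q : Prop) : Supermod (ind (p ∧ q)) (ind p) (ind q) (ind (p ∨ q)) := by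
  by_cases hp : p <;> by_cases hq : q <;> constructor <;> simp [ind, hp, hq]

theorem ind_and (p q : Prop) : ind (p ∧ q) = ind p * ind q := by
  by_cases hp : p <;> by_cases hq : q <;> simp [ind, hp, hq]

section TracePow

open Matrix

variable {ι κ : Type*} [Fintype ι] [DecidableEq ι] [Fintype κ] [DecidableEq κ]

/-- Traces of powers only see the support of a matrix. -/
theorem trace_pow_submatrix (A : Matrix ι ι ℝ) {φ : κ → ι} (hφ : Function.Injective φ)
    (hA : ∀ i j, A i j ≠ 0 → i ∈ Set.range φ ∧ j ∈ Set.range φ) (k : ℕ) :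
    ((A.submatrix φ φ) ^ (k + 1)).trace = (A ^ (k + 1)).trace := by
  have hpow : ∀ (k : ℕ) (a b : κ), ((A.submatrix φ φ) ^ k) a b = (A ^ k) (φ a) (φ b) := by
    intro k
    induction k with
    | zero => intro a b; simp [Matrix.one_apply, hφ.eq_iff]
    | succ k ih =>
      intro a b
      rw [pow_succ', pow_succ', Matrix.mul_apply, Matrix.mul_apply]
      refine Fintype.sum_of_injective φ hφ _ _ (fun i hi => ?_) fun i => by simp [ih]
      rw [show A (φ a) i = 0 by by_contra h; exact hi (hA _ _ h).2, zero_mul]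
  refine Fintype.sum_of_injective φ hφ _ _ (fun i hi => ?_) fun i => hpow _ i i
  rw [Matrix.diag_apply, pow_succ', Matrix.mul_apply]
  refine Finset.sum_eq_zero fun j _ => ?_
  rw [show A i j = 0 by by_contra h; exact hi (hA _ _ h).1, zero_mul]

theorem trace_pow_le_of_le {A B : Matrix ι ι ℝ} (hA : ∀ i j, 0 ≤ A i j) (h : ∀ i j, A i j ≤ B i j)
    (k : ℕ) : (A ^ k).trace ≤ (B ^ k).trace := by
  -- Monotonicity is the degenerate quadruple `A, A, B, B`.
  have := (Supermod.trace_pow (my := A) (ma := A) (mb := B) (mx := B)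
    (fun i j => ⟨hA i j, le_rfl, h i j, by linarith [h i j]⟩) k).le_right
  exact this

end TracePow

section FinsetMoment

open Matrix

variable {α : Type*} [DecidableEq α]

/-- The number of closed walks of length `k` in the subgraph of `G` induced on `S`. -/
noncomputable def finsetMoment (G : SimpleGraph α) (S : Finset α) (k : ℕ) : ℝ :=
  ((Matrix.of fun i j : S => ind (G.Adj i j)) ^ k).trace

/-- The adjacency matrix of the subgraph induced on `S`, pulled back along `φ`. -/
noncomputable def adjOn {α ι : Type*} (G : SimpleGraph α) (S : Finset α) (φ : ι → α) :
    Matrix ι ι ℝ :=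
  Matrix.of fun i j => ind (φ i ∈ S ∧ φ j ∈ S ∧ G.Adj (φ i) (φ j))

/-- Indices mapped outside `S` have zero rows and columns, invisible to positive powers; in the
zeroth power they would still be counted. This lets `S` and its polarization be compared on one
common index type. -/
theorem trace_adjOn_pow {ι : Type*} [Fintype ι] [DecidableEq ι] (G : SimpleGraph α)
    (S : Finset α) {φ : ι → α} (hφ : Function.Injective φ) (hS : ∀ a ∈ S, a ∈ Set.range φ) (k : ℕ) :
    (adjOn G S φ ^ (k + 1)).trace = finsetMoment G S (k + 1) := by
  choose ψ hψ using fun a : S => hS a a.2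
  have hinj : Function.Injective ψ := fun a b h => Subtype.ext (by rw [← hψ a, ← hψ b, h])
  rw [finsetMoment, ← trace_pow_submatrix (adjOn G S φ) hinj]
  · congr 2
    ext a b
    simp [adjOn, hψ]
  · intro i j hij
    have : φ i ∈ S ∧ φ j ∈ S ∧ G.Adj (φ i) (φ j) := by
      by_contra h; exact hij (ind_of_false h)
    exact ⟨⟨⟨φ i, this.1⟩, hφ (hψ _)⟩, ⟨⟨φ j, this.2.1⟩, hφ (hψ _)⟩⟩

/-- `P` parametrizes a component of `G` minus an edge `{u, P c}`, namely the one not containing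
`u`. -/
structure IsBranch {α H : Type*} (G : SimpleGraph α) (c : H) (P : H → α) (u : α) : Prop where
  inj : Function.Injective P
  nbr : ∀ z a, G.Adj (P z) a → (∃ z', a = P z') ∨ (z = c ∧ a = u)
  adj_root : G.Adj u (P c)
  ne : ∀ z, P z ≠ u

/-- The inclusion of a finite part of the graph split as a rest `F` and parts of two branches. -/
def branchMap {α H : Type*} (P N : H → α) (F : Finset α) (K : Finset H) : F ⊕ (K ⊕ K) → α :=
  Sum.elim (fun a => a.1) (Sum.elim (fun z => P z.1) (fun z => N z.1))

theorem branchMap_injective {α H : Type*} {P N : H → α} (hP : Function.Injective P)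
    (hN : Function.Injective N) (hPN : ∀ z z', P z ≠ N z') {F : Finset α} {K : Finset H}
    (hF : ∀ a ∈ F, (∀ z, a ≠ P z) ∧ ∀ z, a ≠ N z) :
    Function.Injective (branchMap P N F K) := by
  rintro (⟨a, ha⟩ | ⟨a, ha⟩ | ⟨a, ha⟩) (⟨b, hb⟩ | ⟨b, hb⟩ | ⟨b, hb⟩) h <;>
    simp only [branchMap, Sum.elim_inl, Sum.elim_inr] at h
  · simp [h]
  · exact absurd h ((hF a ha).1 b)
  · exact absurd h ((hF a ha).2 b)
  · exact absurd h.symm ((hF b hb).1 a)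
  · simp [hP h]
  · exact absurd h (hPN a b)
  · exact absurd h.symm ((hF b hb).2 a)
  · exact absurd h.symm (hPN b a)
  · simp [hN h]

/-- The same finite `K` serves both branches, so that the two branch matrices have a common index
type; surplus vertices are harmless. -/
theorem exists_branchMap_cover {α H : Type*} {P N : H → α}
    (hP : Function.Injective P) (hN : Function.Injective N) (S : Finset α) (c : H) :
    ∃ (F : Finset α) (K : Finset H), c ∈ K ∧ (∀ a ∈ F, (∀ z, a ≠ P z) ∧ ∀ z, a ≠ N z) ∧
      ∀ a ∈ S, a ∈ Set.range (branchMap P N F K) := by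
  classical
  refine ⟨S.filter fun a => (∀ z, a ≠ P z) ∧ ∀ z, a ≠ N z,
    insert c (S.preimage P hP.injOn ∪ S.preimage N hN.injOn), Finset.mem_insert_self _ _,
    fun a ha => (Finset.mem_filter.1 ha).2, fun a ha => ?_⟩
  by_cases h1 : ∃ z, a = P z
  · obtain ⟨z, rfl⟩ := h1
    exact ⟨Sum.inr (Sum.inl ⟨z, by simp [ha]⟩), rfl⟩
  by_cases h2 : ∃ z, a = N z
  · obtain ⟨z, rfl⟩ := h2
    exact ⟨Sum.inr (Sum.inr ⟨z, by simp [ha]⟩), rfl⟩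
  · push Not at h1 h2
    exact ⟨Sum.inl ⟨a, Finset.mem_filter.2 ⟨ha, h1, h2⟩⟩, rfl⟩

variable {H : Type*} [DecidableEq H] {G : SimpleGraph α} {P N : H → α} {c : H}

/-- The adjacency matrix of the part of a branch selected by `p`. -/
noncomputable def branchMatrix {α H : Type*} (G : SimpleGraph α) (P : H → α) (K : Finset H)
    (p : H → Prop) : Matrix K K ℝ :=
  Matrix.of fun z z' => ind (p z.1 ∧ p z'.1) * ind (G.Adj (P z.1) (P z'.1))

theorem branchMatrix_isSymm {α H : Type*} (G : SimpleGraph α) (P : H → α) (K : Finset H)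
    (p : H → Prop) : (branchMatrix G P K p).IsSymm := by
  ext z z'
  simp [branchMatrix, and_comm, G.adj_comm]

theorem branchMatrix_supermod {α H : Type*} (G : SimpleGraph α) (P : H → α) (K : Finset H)
    (p q : H → Prop) (z z' : K) : Supermod (branchMatrix G P K (fun z => p z ∧ q z) z z')
      (branchMatrix G P K p z z') (branchMatrix G P K q z z')
      (branchMatrix G P K (fun z => p z ∨ q z) z z') := by
  simp only [branchMatrix, Matrix.of_apply, ind_and]
  have h := fun z => ind_supermod (p z) (q z)
  simp only [ind_and] at h
  exact ((h z).mul (h z')).mul (Supermod.const (ind_nonneg _))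

theorem IsBranch.adj_iff {α H : Type*} {G : SimpleGraph α} {P : H → α} {c : H} {u a : α}
    (hP : IsBranch G c P u) (ha : ∀ z, a ≠ P z) (z : H) : G.Adj a (P z) ↔ a = u ∧ z = c := by
  refine ⟨fun h => ?_, fun h => h.1 ▸ h.2 ▸ hP.adj_root⟩
  rcases hP.nbr z a h.symm with ⟨z', hz'⟩ | ⟨h1, h2⟩
  · exact absurd hz' (ha z')
  · exact ⟨h2, h1⟩

theorem adjOn_branchMap_vertex {v : α} (hP : IsBranch G c P v) (hN : IsBranch G c N v)
    (hPN : ∀ z z', P z ≠ N z') (hadj : ∀ z z', G.Adj (P z) (P z') ↔ G.Adj (N z) (N z'))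
    {F : Finset α} {K : Finset H} (hF : ∀ a ∈ F, (∀ z, a ≠ P z) ∧ ∀ z, a ≠ N z)
    (hv : v ∈ F) (hc : c ∈ K) (S : Finset α) :
    adjOn G S (branchMap P N F K) =
      threeBlocks (adjOn G S fun a : F => a.1) (branchMatrix G P K fun z => P z ∈ S)
        (branchMatrix G P K fun z => N z ∈ S) +
      (ind (v ∈ S ∧ P c ∈ S) • coupling (Sum.inl ⟨v, hv⟩) (Sum.inr (Sum.inl ⟨c, hc⟩)) +
        ind (v ∈ S ∧ N c ∈ S) • coupling (Sum.inl ⟨v, hv⟩) (Sum.inr (Sum.inr ⟨c, hc⟩))) := by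
  have hPa : ∀ a (_ : a ∈ F) z, G.Adj a (P z) ↔ a = v ∧ z = c := fun a ha z =>
    hP.adj_iff (hF a ha).1 z
  have hNa : ∀ a (_ : a ∈ F) z, G.Adj a (N z) ↔ a = v ∧ z = c := fun a ha z =>
    hN.adj_iff (hF a ha).2 z
  have hPNa : ∀ z z', ¬G.Adj (N z) (P z') := fun z z' h =>
    hN.ne z ((hP.adj_iff (fun z' => (hPN z' z).symm) z').1 h).1
  ext i j
  rcases i with ⟨a, ha⟩ | ⟨a, ha⟩ | ⟨a, ha⟩ <;> rcases j with ⟨b, hb⟩ | ⟨b, hb⟩ | ⟨b, hb⟩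
  · simp [adjOn, branchMap, threeBlocks, coupling, Matrix.single]
  · by_cases h : v = a ∧ c = b
    · obtain ⟨rfl, rfl⟩ := h
      simp [adjOn, branchMap, threeBlocks, coupling, Matrix.single, hP.adj_root]
    · simp [adjOn, branchMap, threeBlocks, coupling, Matrix.single, hPa a ha, h, eq_comm (b := v),
        eq_comm (b := c), ind_of_false]
  · by_cases h : v = a ∧ c = b
    · obtain ⟨rfl, rfl⟩ := h
      simp [adjOn, branchMap, threeBlocks, coupling, Matrix.single, hN.adj_root]
    · simp [adjOn, branchMap, threeBlocks, coupling, Matrix.single, hNa a ha, h, eq_comm (b := v),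
        eq_comm (b := c), ind_of_false]
  · by_cases h : c = a ∧ v = b
    · obtain ⟨rfl, rfl⟩ := h
      simp [adjOn, branchMap, threeBlocks, coupling, Matrix.single, hP.adj_root.symm, and_comm]
    · simp [adjOn, branchMap, threeBlocks, coupling, Matrix.single, G.adj_comm (P a) b, hPa b hb,
        h, eq_comm (b := v), eq_comm (b := c)]
      exact ind_of_false fun hh => h ⟨hh.2.2.2, hh.2.2.1⟩
  · simp [adjOn, branchMap, threeBlocks, coupling, Matrix.single, branchMatrix, ← ind_and,
      and_assoc]
  · simp [adjOn, branchMap, threeBlocks, coupling, Matrix.single, G.adj_comm (P a), hPNa,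
      ind_of_false]
  · by_cases h : c = a ∧ v = b
    · obtain ⟨rfl, rfl⟩ := h
      simp [adjOn, branchMap, threeBlocks, coupling, Matrix.single, hN.adj_root.symm, and_comm]
    · simp [adjOn, branchMap, threeBlocks, coupling, Matrix.single, G.adj_comm (N a) b, hNa b hb,
        h, eq_comm (b := v), eq_comm (b := c)]
      exact ind_of_false fun hh => h ⟨hh.2.2.2, hh.2.2.1⟩
  · simp [adjOn, branchMap, threeBlocks, coupling, Matrix.single, hPNa, ind_of_false]
  · simp [adjOn, branchMap, threeBlocks, coupling, Matrix.single, branchMatrix, ← ind_and,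
      and_assoc, hadj]

theorem adjOn_branchMap_edge (hP : IsBranch G c P (N c)) (hN : IsBranch G c N (P c))
    (hPN : ∀ z z', P z ≠ N z') (hadj : ∀ z z', G.Adj (P z) (P z') ↔ G.Adj (N z) (N z'))
    {F : Finset α} {K : Finset H} (hF : ∀ a ∈ F, (∀ z, a ≠ P z) ∧ ∀ z, a ≠ N z)
    (hc : c ∈ K) (S : Finset α) :
    adjOn G S (branchMap P N F K) =
      threeBlocks (adjOn G S fun a : F => a.1) (branchMatrix G P K fun z => P z ∈ S)
        (branchMatrix G P K fun z => N z ∈ S) +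
      ind (P c ∈ S ∧ N c ∈ S) •
        coupling (Sum.inr (Sum.inl ⟨c, hc⟩)) (Sum.inr (Sum.inr ⟨c, hc⟩)) := by
  have hPa : ∀ a (_ : a ∈ F) z, ¬G.Adj a (P z) := fun a ha z h =>
    (hF a ha).2 c ((hP.adj_iff (hF a ha).1 z).1 h).1
  have hNa : ∀ a (_ : a ∈ F) z, ¬G.Adj a (N z) := fun a ha z h =>
    (hF a ha).1 c ((hN.adj_iff (hF a ha).2 z).1 h).1
  have hPNa : ∀ z z', G.Adj (N z) (P z') ↔ z = c ∧ z' = c := fun z z' => by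
    rw [hP.adj_iff (fun z' => (hPN z' z).symm) z', hN.inj.eq_iff]
  ext i j
  rcases i with ⟨a, ha⟩ | ⟨a, ha⟩ | ⟨a, ha⟩ <;> rcases j with ⟨b, hb⟩ | ⟨b, hb⟩ | ⟨b, hb⟩
  · simp [adjOn, branchMap, threeBlocks, coupling, Matrix.single]
  · simp [adjOn, branchMap, threeBlocks, coupling, Matrix.single, hPa a ha, ind_of_false]
  · simp [adjOn, branchMap, threeBlocks, coupling, Matrix.single, hNa a ha, ind_of_false]
  · simp [adjOn, branchMap, threeBlocks, coupling, Matrix.single, G.adj_comm (P a), hPa b hb,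
      ind_of_false]
  · simp [adjOn, branchMap, threeBlocks, coupling, Matrix.single, branchMatrix, ← ind_and,
      and_assoc]
  · by_cases h : c = a ∧ c = b
    · obtain ⟨rfl, rfl⟩ := h
      simp [adjOn, branchMap, threeBlocks, coupling, Matrix.single, hN.adj_root]
    · simp [adjOn, branchMap, threeBlocks, coupling, Matrix.single, G.adj_comm (P a), hPNa,
        h, eq_comm (b := c)]
      exact ind_of_false fun hh => h ⟨hh.2.2.2, hh.2.2.1⟩
  · simp [adjOn, branchMap, threeBlocks, coupling, Matrix.single, G.adj_comm (N a), hNa b hb,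
      ind_of_false]
  · by_cases h : c = a ∧ c = b
    · obtain ⟨rfl, rfl⟩ := h
      simp [adjOn, branchMap, threeBlocks, coupling, Matrix.single, hP.adj_root, and_comm]
    · simp [adjOn, branchMap, threeBlocks, coupling, Matrix.single, hPNa, h, eq_comm (b := c),
        ind_of_false]
  · simp [adjOn, branchMap, threeBlocks, coupling, Matrix.single, branchMatrix, ← ind_and,
      and_assoc, hadj]

/-- `S'` arises from `S` by moving the vertices of the branch `N` to their free mirror images in
the branch `P`. -/
structure IsPolarization {α H : Type*} (P N : H → α) (S S' : Finset α) : Prop where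
  mem_pos : ∀ z, P z ∈ S' ↔ P z ∈ S ∨ N z ∈ S
  mem_neg : ∀ z, N z ∈ S' ↔ P z ∈ S ∧ N z ∈ S
  mem_rest : ∀ a, (∀ z, a ≠ P z) → (∀ z, a ≠ N z) → (a ∈ S' ↔ a ∈ S)

theorem adjOn_rest {α H : Type*} {G : SimpleGraph α} {P N : H → α} {S S' : Finset α} (h : IsPolarization P N S S') {F : Finset α}
    (hF : ∀ a ∈ F, (∀ z, a ≠ P z) ∧ ∀ z, a ≠ N z) :
    adjOn G S' (fun a : F => a.1) = adjOn G S (fun a : F => a.1) := by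
  ext ⟨a, ha⟩ ⟨b, hb⟩
  simp [adjOn, h.mem_rest a (hF a ha).1 (hF a ha).2, h.mem_rest b (hF b hb).1 (hF b hb).2]

theorem adjOn_isSymm {α ι : Type*} (G : SimpleGraph α) (S : Finset α) (φ : ι → α) :
    (adjOn G S φ).IsSymm := by
  ext i j
  simp only [Matrix.transpose_apply, adjOn, Matrix.of_apply]
  congr 1
  rw [G.adj_comm]
  exact propext ⟨fun h => ⟨h.2.1, h.1, h.2.2⟩, fun h => ⟨h.2.1, h.1, h.2.2⟩⟩

/-- On `K` the new branches are selected by the disjunction and the conjunction of the old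
membership conditions, and `hadj` identifies the adjacency of both branches. -/
theorem finsetMoment_le_of_vertex {v : α} (hP : IsBranch G c P v) (hN : IsBranch G c N v)
    (hPN : ∀ z z', P z ≠ N z') (hadj : ∀ z z', G.Adj (P z) (P z') ↔ G.Adj (N z) (N z'))
    {S S' : Finset α} (h : IsPolarization P N S S') (k : ℕ) :
    finsetMoment G S (k + 1) ≤ finsetMoment G S' (k + 1) := by
  obtain ⟨F, K, hc, hF, hcov⟩ := exists_branchMap_cover hP.inj hN.inj (insert v (S ∪ S')) c
  have hv : v ∈ F := by
    obtain ⟨(a | a | a), ha⟩ := hcov v (Finset.mem_insert_self _ _)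
    · exact ha ▸ a.2
    · exact absurd ha (hP.ne a)
    · exact absurd ha (hN.ne a)
  have hinj := branchMap_injective (K := K) hP.inj hN.inj hPN hF
  rw [← trace_adjOn_pow G S hinj (fun a ha => hcov a (by simp [ha])),
    ← trace_adjOn_pow G S' hinj (fun a ha => hcov a (by simp [ha])),
    adjOn_branchMap_vertex hP hN hPN hadj hF hv hc, adjOn_branchMap_vertex hP hN hPN hadj hF hv hc,
    adjOn_rest h hF]
  have hvS : v ∈ S' ↔ v ∈ S := h.mem_rest v (hF v hv).1 (hF v hv).2
  simp only [h.mem_pos, h.mem_neg, hvS]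
  refine trace_pow_le_of_vertex (fun i j => ind_nonneg _) (adjOn_isSymm _ _ _)
    (branchMatrix_supermod G P K _ _) (branchMatrix_isSymm _ _ _ _) (branchMatrix_isSymm _ _ _ _)
    (branchMatrix_isSymm _ _ _ _) (branchMatrix_isSymm _ _ _ _) ?_ _ _ _
  have := (Supermod.const (ind_nonneg (v ∈ S))).mul (ind_supermod (P c ∈ S) (N c ∈ S))
  simpa only [← ind_and] using this

theorem finsetMoment_le_of_edge (hP : IsBranch G c P (N c)) (hN : IsBranch G c N (P c))
    (hPN : ∀ z z', P z ≠ N z') (hadj : ∀ z z', G.Adj (P z) (P z') ↔ G.Adj (N z) (N z'))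
    {S S' : Finset α} (h : IsPolarization P N S S') (k : ℕ) :
    finsetMoment G S (k + 1) ≤ finsetMoment G S' (k + 1) := by
  obtain ⟨F, K, hc, hF, hcov⟩ := exists_branchMap_cover hP.inj hN.inj (S ∪ S') c
  have hinj := branchMap_injective (K := K) hP.inj hN.inj hPN hF
  rw [← trace_adjOn_pow G S hinj (fun a ha => hcov a (by simp [ha])),
    ← trace_adjOn_pow G S' hinj (fun a ha => hcov a (by simp [ha])),
    adjOn_branchMap_edge hP hN hPN hadj hF hc, adjOn_branchMap_edge hP hN hPN hadj hF hc,
    adjOn_rest h hF]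
  simp only [h.mem_pos, h.mem_neg]
  -- The joining edge is present before polarization exactly when it is present afterwards. If
  -- absent, the supermodularity of traces suffices.
  by_cases hcc : P c ∈ S ∧ N c ∈ S
  · rw [ind_of_true hcc, ind_of_true ⟨Or.inl hcc.1, hcc⟩, one_smul]
    refine trace_pow_le_of_edge _
      (branchMatrix_supermod G P K _ _) (branchMatrix_isSymm _ _ _ _) (branchMatrix_isSymm _ _ _ _)
      (branchMatrix_isSymm _ _ _ _) (branchMatrix_isSymm _ _ _ _) (adjOn_isSymm _ _ _) _ ?_ _
    simp [branchMatrix, ind]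
  · rw [ind_of_false hcc, ind_of_false (fun h => hcc h.2), zero_smul, add_zero, add_zero,
      trace_threeBlocks_pow, trace_threeBlocks_pow]
    have := (Supermod.trace_pow (branchMatrix_supermod G P K (fun z => P z ∈ S)
      (fun z => N z ∈ S)) (k + 1)).add_le
    linarith

end FinsetMoment

/-! ### The regular tree on ℕ in breadth-first order. -/

/-- The parent of the vertex `j ≥ 1` in the infinite `(d + 1)`-regular tree on `ℕ`. -/
def regParent (d j : ℕ) : ℕ := (j - 2) / d

/-- The `s`-th child of `a`, for `s < d`; besides these, the vertex `0` has the child `1`. -/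
def regChild (d a s : ℕ) : ℕ := d * a + 2 + s

/-- The neighbour of `a` that is not of the form `regChild d a s`. -/
def regUp (d a : ℕ) : ℕ := if a = 0 then 1 else regParent d a

theorem regParent_zero (d : ℕ) : regParent d 0 = 0 := by simp [regParent]

theorem regParent_lt {d j : ℕ} (hj : 0 < j) : regParent d j < j := by
  unfold regParent
  have := Nat.div_le_self (j - 2) d
  rcases Nat.lt_or_ge j 2 with h | h
  · rw [show j - 2 = 0 by omega, Nat.zero_div]; exact hj
  · omega

theorem regParent_le (d j : ℕ) : regParent d j ≤ j := by
  rcases Nat.eq_zero_or_pos j with rfl | h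
  · simp [regParent_zero]
  · exact (regParent_lt h).le

theorem regParent_mono (d : ℕ) {i j : ℕ} (h : i ≤ j) : regParent d i ≤ regParent d j :=
  Nat.div_le_div_right (Nat.sub_le_sub_right h 2)

theorem regParent_regChild {d a s : ℕ} (hs : s < d) : regParent d (regChild d a s) = a := by
  unfold regParent regChild
  rw [show d * a + 2 + s - 2 = s + d * a by omega, Nat.add_mul_div_left _ _ (by omega),
    Nat.div_eq_of_lt hs, zero_add]

theorem regChild_regParent {d j : ℕ} (hj : 2 ≤ j) :
    regChild d (regParent d j) ((j - 2) % d) = j := by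
  unfold regParent regChild
  have := Nat.div_add_mod (j - 2) d
  omega

theorem lt_regChild {d a s : ℕ} (hd : 0 < d) : a < regChild d a s := by
  unfold regChild
  have := Nat.le_mul_of_pos_left a hd
  omega

/-- The infinite `(d + 1)`-regular tree, with its vertices numbered in breadth-first order. -/
def regularTree (d : ℕ) : SimpleGraph ℕ where
  Adj i j := (0 < j ∧ i = regParent d j) ∨ (0 < i ∧ j = regParent d i)
  symm := ⟨fun _ _ h => h.symm⟩
  loopless := ⟨fun i h => by
    rcases h with h | h <;> exact absurd (regParent_lt (d := d) h.1) (by omega)⟩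

theorem regularTree_adj_parent {d j : ℕ} (hj : 0 < j) : (regularTree d).Adj (regParent d j) j :=
  Or.inl ⟨hj, rfl⟩

section RegularTree

variable {d : ℕ} [NeZero d]

/-- The convention that `1` is the upward neighbour of `0` makes all vertices alike: one upward
neighbour and `d` children slots. -/
theorem regularTree_adj_iff {a b : ℕ} :
    (regularTree d).Adj a b ↔ b = regUp d a ∨ ∃ s : Fin d, b = regChild d a s := by
  have hd : 0 < d := NeZero.pos d
  constructor
  · rintro (⟨h1, h2⟩ | ⟨h1, h2⟩)
    · rcases Nat.lt_or_ge b 2 with h | h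
      · obtain rfl : b = 1 := by omega
        left; rw [h2]; simp [regUp, regParent]
      · right
        refine ⟨⟨(b - 2) % d, Nat.mod_lt _ hd⟩, ?_⟩
        rw [h2]; exact (regChild_regParent h).symm
    · left; rw [h2, regUp, if_neg (by omega)]
  · rintro (h | ⟨s, h⟩)
    · by_cases ha : a = 0
      · subst ha
        obtain rfl : b = 1 := by simpa [regUp] using h
        left; simp [regParent]
      · right; rw [h, regUp, if_neg ha]; exact ⟨by omega, rfl⟩
    · left
      rw [h, regParent_regChild s.2]
      exact ⟨(Nat.zero_le _).trans_lt (lt_regChild hd), rfl⟩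

theorem regUp_lt_regChild {a s : ℕ} : regUp d a < regChild d a s := by
  have hd : 0 < d := NeZero.pos d
  unfold regUp
  split_ifs with h
  · unfold regChild; omega
  · exact (regParent_le d a).trans_lt (lt_regChild hd)

/-- The neighbours of `a` other than its neighbour `u`, indexed by `Fin d`. -/
def regNext (d u a : ℕ) (s : Fin d) : ℕ :=
  if regChild d a s = u then regUp d a else regChild d a s

theorem regNext_adj (u a : ℕ) (s : Fin d) : (regularTree d).Adj a (regNext d u a s) := by
  rw [regularTree_adj_iff]
  unfold regNext
  split_ifs
  · exact Or.inl rfl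
  · exact Or.inr ⟨s, rfl⟩

theorem regNext_ne (u a : ℕ) (s : Fin d) : regNext d u a s ≠ u := by
  unfold regNext
  split_ifs with h
  · rw [← h]; exact regUp_lt_regChild.ne
  · exact h

theorem regNext_injective (u a : ℕ) : Function.Injective (regNext d u a) := by
  intro s t h
  have h1 := regUp_lt_regChild (d := d) (a := a) (s := s)
  have h2 := regUp_lt_regChild (d := d) (a := a) (s := t)
  unfold regNext at h
  apply Fin.ext
  unfold regChild at *
  split_ifs at h <;> omega

theorem exists_regNext {u a b : ℕ} (hu : (regularTree d).Adj a u) (hb : (regularTree d).Adj a b)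
    (hne : b ≠ u) : ∃ s, b = regNext d u a s := by
  rw [regularTree_adj_iff] at hu hb
  rcases hb with hb | ⟨s, hs⟩
  · rcases hu with hu | ⟨s, hs⟩
    · exact absurd (hb.trans hu.symm) hne
    · exact ⟨s, by rw [regNext, if_pos hs.symm, hb]⟩
  · exact ⟨s, by rw [regNext, if_neg (hs ▸ hne), hs]⟩

/-! ### Non-backtracking walks and the branches they sweep out. -/

/-- `w` is the neighbour of `b` on the way to `u`. -/
def Toward (d u b w : ℕ) : Prop :=
  ((∃ i, w = (regParent d)^[i] u) ∧ regParent d w = b ∧ 0 < w) ∨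
    ((¬∃ i, b = (regParent d)^[i] u) ∧ w = regParent d b)

theorem regParent_iterate_le (d i u : ℕ) : (regParent d)^[i] u ≤ u := by
  induction i with
  | zero => simp
  | succ i ih => rw [Function.iterate_succ_apply']; exact (regParent_le d _).trans ih

theorem exists_regParent_iterate_eq_zero (d u : ℕ) : ∃ i, 0 = (regParent d)^[i] u := by
  induction u using Nat.strong_induction_on with
  | _ u ih =>
    rcases Nat.eq_zero_or_pos u with rfl | hu
    · exact ⟨0, rfl⟩
    · obtain ⟨i, hi⟩ := ih _ (regParent_lt (d := d) hu)
      exact ⟨i + 1, hi⟩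

/-- Two ancestors of `u` with the same parent agree. -/
theorem ancestor_unique {d u w w' : ℕ} (h : ∃ i, w = (regParent d)^[i] u)
    (h' : ∃ i, w' = (regParent d)^[i] u) (hw : 0 < w) (hw' : 0 < w')
    (hp : regParent d w = regParent d w') : w = w' := by
  obtain ⟨i, hi⟩ := h
  obtain ⟨j, hj⟩ := h'
  wlog hij : i ≤ j generalizing i j w w'
  · exact (this hw' hw hp.symm j hj i hi (by omega)).symm
  obtain ⟨k, rfl⟩ := Nat.exists_eq_add_of_le' hij
  cases k with
  | zero => rw [hi, hj, zero_add]
  | succ k =>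
    have : w' = (regParent d)^[k] (regParent d w) := by
      rw [hj, Function.iterate_add_apply, ← hi, Function.iterate_succ_apply]
    have h1 := regParent_iterate_le d k (regParent d w)
    have h2 := regParent_lt (d := d) hw'
    omega

theorem Toward.unique {d u b w w' : ℕ} (h : Toward d u b w) (h' : Toward d u b w') : w = w' := by
  rcases h with ⟨h1, h2, h3⟩ | ⟨h1, h2⟩ <;> rcases h' with ⟨h1', h2', h3'⟩ | ⟨h1', h2'⟩
  · exact ancestor_unique h1 h1' h3 h3' (h2.trans h2'.symm)
  · obtain ⟨i, hi⟩ := h1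
    exact absurd ⟨i + 1, by rw [Function.iterate_succ_apply', ← hi, h2]⟩ h1'
  · obtain ⟨i, hi⟩ := h1'
    exact absurd ⟨i + 1, by rw [Function.iterate_succ_apply', ← hi, h2']⟩ h1
  · rw [h2, h2']

theorem Toward.ne {d u b w : ℕ} (h : Toward d u b w) : b ≠ u := by
  rcases h with ⟨⟨i, hi⟩, h2, h3⟩ | ⟨h1, -⟩
  · have := regParent_iterate_le d i u
    have := regParent_lt (d := d) h3
    omega
  · rintro rfl; exact h1 ⟨0, rfl⟩

theorem Toward.start {d u a : ℕ} (h : (regularTree d).Adj u a) : Toward d u a u := by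
  rcases h with ⟨h1, h2⟩ | ⟨h1, h2⟩
  · right
    refine ⟨?_, h2⟩
    rintro ⟨i, hi⟩
    have := regParent_iterate_le d i u
    have := regParent_lt (d := d) h1
    omega
  · exact Or.inl ⟨⟨0, rfl⟩, h2.symm, h1⟩

/-- A non-backtracking step leads away from `u`, so the vertex just left becomes the direction back.
Together with `Toward.unique`, this is how acyclicity enters. -/
theorem Toward.step {d u b w b' : ℕ} (h : Toward d u b w) (hb : (regularTree d).Adj b b')
    (hne : b' ≠ w) : Toward d u b' b := by
  rcases hb with ⟨h1, h2⟩ | ⟨h1, h2⟩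
  · right
    refine ⟨?_, h2⟩
    rintro ⟨i, hi⟩
    rcases h with ⟨h3, h4, h5⟩ | ⟨h3, -⟩
    · exact hne (ancestor_unique ⟨i, hi⟩ h3 h1 h5 (by rw [h4, h2]))
    · exact h3 ⟨i + 1, by rw [Function.iterate_succ_apply', ← hi, h2]⟩
  · rcases h with ⟨⟨i, hi⟩, h4, h5⟩ | ⟨-, h3⟩
    · exact Or.inl ⟨⟨i + 1, by rw [Function.iterate_succ_apply', ← hi, h4]⟩, h2.symm, h1⟩
    · exact absurd (h2.trans h3.symm) hne

/-- The oriented edge reached from `(u, a)` by the non-backtracking walk described by a word, whose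
letters (newest first) are relabelled by the permutations `π`. -/
def regDart (d u a : ℕ) (π : ℕ → Equiv.Perm (Fin d)) : List (Fin d) → ℕ × ℕ
  | [] => (u, a)
  | s :: z => ((regDart d u a π z).2,
      regNext d (regDart d u a π z).1 (regDart d u a π z).2 (π z.length s))

/-- The vertex reached from `(u, a)` by the non-backtracking walk described by a word. -/
def regWalk (d u a : ℕ) (π : ℕ → Equiv.Perm (Fin d)) (z : List (Fin d)) : ℕ :=
  (regDart d u a π z).2

variable {u a : ℕ} {π : ℕ → Equiv.Perm (Fin d)}

theorem regDart_adj (h : (regularTree d).Adj u a) (z : List (Fin d)) :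
    (regularTree d).Adj (regDart d u a π z).1 (regDart d u a π z).2 := by
  cases z with
  | nil => exact h
  | cons s z => exact regNext_adj _ _ _

theorem regDart_toward (h : (regularTree d).Adj u a) (z : List (Fin d)) :
    Toward d u (regDart d u a π z).2 (regDart d u a π z).1 := by
  induction z with
  | nil => exact Toward.start h
  | cons s z ih => exact ih.step (regNext_adj _ _ _) (regNext_ne _ _ _)

theorem regWalk_ne (h : (regularTree d).Adj u a) (z : List (Fin d)) : regWalk d u a π z ≠ u :=
  (regDart_toward h z).ne

/-- The end vertex determines its predecessor, so equal ends can be traced back letter by letter; a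
shorter word would force a visit to `u`. -/
theorem regWalk_injective (h : (regularTree d).Adj u a) : Function.Injective (regWalk d u a π) := by
  have hprev : ∀ z z' : List (Fin d), regWalk d u a π z = regWalk d u a π z' →
      (regDart d u a π z).1 = (regDart d u a π z').1 := fun z z' hz =>
    (regDart_toward h z).unique (by
      have := regDart_toward (π := π) h z'
      unfold regWalk at hz
      rwa [← hz] at this)
  intro z
  induction z with
  | nil =>
    intro z' hz
    cases z' with
    | nil => rfl
    | cons s y => exact absurd (hprev _ _ hz).symm (regWalk_ne h y)
  | cons s y ih =>
    intro z' hz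
    cases z' with
    | nil => exact absurd (hprev _ _ hz) (regWalk_ne h y)
    | cons s' y' =>
      obtain rfl := ih (hprev _ _ hz)
      have := (π y.length).injective (regNext_injective _ _ hz)
      rw [this]

theorem regWalk_ne_regWalk {a' : ℕ} {π' : ℕ → Equiv.Perm (Fin d)}
    (h : (regularTree d).Adj u a) (h' : (regularTree d).Adj u a') (hne : a ≠ a')
    (z z' : List (Fin d)) : regWalk d u a π z ≠ regWalk d u a' π' z' := by
  have hprev : ∀ z z' : List (Fin d), regWalk d u a π z = regWalk d u a' π' z' →
      (regDart d u a π z).1 = (regDart d u a' π' z').1 := fun z z' hz =>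
    (regDart_toward h z).unique (by
      have := regDart_toward (π := π') h' z'
      unfold regWalk at hz
      rwa [← hz] at this)
  induction z generalizing z' with
  | nil =>
    intro hz
    cases z' with
    | nil => exact hne hz
    | cons s y => exact regWalk_ne h' y (hprev _ _ hz).symm
  | cons s y ih =>
    intro hz
    cases z' with
    | nil => exact regWalk_ne h y (hprev _ _ hz)
    | cons s' y' => exact ih y' (hprev _ _ hz)

theorem regWalk_neighbour (h : (regularTree d).Adj u a) (z : List (Fin d)) {b : ℕ}
    (hb : (regularTree d).Adj (regWalk d u a π z) b) :
    (∃ s, b = regWalk d u a π (s :: z)) ∨ (∃ s y, z = s :: y ∧ b = regWalk d u a π y) ∨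
      (z = [] ∧ b = u) := by
  by_cases hbz : b = (regDart d u a π z).1
  · right
    cases z with
    | nil => exact Or.inr ⟨rfl, hbz⟩
    | cons s y => exact Or.inl ⟨s, y, rfl, hbz⟩
  · left
    obtain ⟨s, hs⟩ := exists_regNext (regDart_adj h z).symm hb hbz
    refine ⟨(π z.length).symm s, ?_⟩
    rw [hs]
    simp [regWalk, regDart]

theorem regWalk_isBranch (h : (regularTree d).Adj u a) :
    IsBranch (regularTree d) [] (regWalk d u a π) u where
  inj := regWalk_injective h
  nbr z b hb := by
    rcases regWalk_neighbour h z hb with ⟨s, hs⟩ | ⟨s, y, -, hy⟩ | hu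
    · exact Or.inl ⟨_, hs⟩
    · exact Or.inl ⟨_, hy⟩
    · exact Or.inr hu
  adj_root := h
  ne := regWalk_ne h

theorem regWalk_adj_iff (h : (regularTree d).Adj u a) (z z' : List (Fin d)) :
    (regularTree d).Adj (regWalk d u a π z) (regWalk d u a π z') ↔
      (∃ s, z' = s :: z) ∨ ∃ s, z = s :: z' := by
  constructor
  · intro hz
    rcases regWalk_neighbour h z hz with ⟨s, hs⟩ | ⟨s, y, hy, hb⟩ | ⟨-, hu⟩
    · exact Or.inl ⟨s, regWalk_injective h hs⟩
    · obtain rfl := regWalk_injective h hb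
      exact Or.inr ⟨s, hy⟩
    · exact absurd hu (regWalk_ne h z')
  · rintro (⟨s, rfl⟩ | ⟨s, rfl⟩)
    · exact regDart_adj h (s :: z)
    · exact (regDart_adj h (s :: z')).symm

theorem regDart_append {d : ℕ} (u a : ℕ) (π : ℕ → Equiv.Perm (Fin d)) (y : List (Fin d)) (s : Fin d) :
    regDart d u a π (y ++ [s]) =
      regDart d a (regNext d u a (π 0 s)) (fun i => π (i + 1)) y := by
  induction y with
  | nil => rfl
  | cons t y ih => simp [regDart, ih]

/-- The oldest letter of `z'` leaves `u` for a neighbour other than `a`, so the rest runs in another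
branch at `u`. -/
theorem regWalk_ne_regWalk_reverse {π' : ℕ → Equiv.Perm (Fin d)} (h : (regularTree d).Adj u a)
    (z z' : List (Fin d)) : regWalk d u a π z ≠ regWalk d a u π' z' := by
  rcases List.eq_nil_or_concat' z' with rfl | ⟨y, s, rfl⟩
  · exact regWalk_ne h z
  · have : regWalk d a u π' (y ++ [s]) =
        regWalk d u (regNext d a u (π' 0 s)) (fun i => π' (i + 1)) y := by
      rw [regWalk, regDart_append, regWalk]
    rw [this]
    exact regWalk_ne_regWalk h (regNext_adj _ _ _) (regNext_ne _ _ _).symm _ _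

theorem regUp_regChild {d a s : ℕ} (hs : s < d) : regUp d (regChild d a s) = a := by
  rw [regUp, if_neg ((Nat.zero_le a).trans_lt (lt_regChild (by omega))).ne', regParent_regChild hs]

theorem regDart_fst_eq_regUp {b : ℕ} (z : List (Fin d)) :
    (regDart d (regUp d b) b π z).1 = regUp d (regDart d (regUp d b) b π z).2 := by
  induction z with
  | nil => rfl
  | cons s z ih =>
    simp only [regDart]
    rw [ih, regNext, if_neg regUp_lt_regChild.ne', regUp_regChild (Fin.is_lt _)]

/-- The walk from `b` always descends, while the walk from `a` takes a child or something smaller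
than a child. Breadth-first numbering puts all children of a smaller vertex before those of a larger
one. -/
theorem regWalk_lt_regWalk {b : ℕ} {π' : ℕ → Equiv.Perm (Fin d)} (hab : a < b)
    (z z' : List (Fin d)) (hz : z.length = z'.length) :
    regWalk d u a π z < regWalk d (regUp d b) b π' z' := by
  induction z generalizing z' with
  | nil =>
    obtain rfl := List.length_eq_zero_iff.1 hz.symm
    exact hab
  | cons s y ih =>
    cases z' with
    | nil => simp at hz
    | cons s' y' =>
      have hy := ih y' (by simpa using hz)
      have hd : 0 < d := NeZero.pos d
      simp only [regWalk, regDart] at hy ⊢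
      rw [regDart_fst_eq_regUp, regNext, regNext, if_neg regUp_lt_regChild.ne']
      generalize (regDart d u a π y).2 = i at *
      generalize (regDart d (regUp d b) b π' y').2 = j at *
      generalize π y.length s = t
      generalize π' y'.length s' = t'
      have hlt : regChild d i t < regChild d j t' := by
        unfold regChild
        have := Nat.mul_le_mul_left d (show i + 1 ≤ j from hy)
        have := t.2
        rw [Nat.mul_add] at *
        omega
      split_ifs
      · exact regUp_lt_regChild.trans hlt
      · exact hlt

theorem regDart_congr {d u a : ℕ} {π π' : ℕ → Equiv.Perm (Fin d)} (z : List (Fin d))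
    (h : ∀ i < z.length, π i = π' i) : regDart d u a π z = regDart d u a π' z := by
  induction z with
  | nil => rfl
  | cons s z ih =>
    simp only [regDart]
    rw [ih fun i hi => h i (by simp; omega), h z.length (by simp)]

/-- The oriented edge `(w, x)` is reached from `(u, a)` by a non-backtracking walk of length
`m`. -/
def RegReach (d : ℕ) [NeZero d] (u a m w x : ℕ) : Prop :=
  ∃ π : ℕ → Equiv.Perm (Fin d), regDart d u a π (List.replicate m 0) = (w, x)

theorem RegReach.step {m w x x' : ℕ} (h : RegReach d u a m w x) (hw : (regularTree d).Adj x w)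
    (hx : (regularTree d).Adj x x') (hne : x' ≠ w) : RegReach d u a (m + 1) x x' := by
  obtain ⟨π, hπ⟩ := h
  obtain ⟨s, hs⟩ := exists_regNext hw hx hne
  -- Relabelling the letter `0` at position `m` as `s` keeps the word constant, so that `x` and `y`
  -- will correspond to the same word of zeros.
  refine ⟨Function.update π m (Equiv.swap 0 s), ?_⟩
  have : regDart d u a (Function.update π m (Equiv.swap 0 s)) (List.replicate m 0) = (w, x) := by
    rw [← hπ]
    refine regDart_congr _ fun i hi => ?_
    rw [List.length_replicate] at hi
    rw [Function.update_of_ne hi.ne]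
  rw [List.replicate_succ]
  simp [regDart, this, hs]

theorem exists_child_ancestor {d x y i : ℕ} (h : x = (regParent d)^[i] y) (hxy : x < y) :
    ∃ x₁ j, 0 < x₁ ∧ regParent d x₁ = x ∧ x₁ = (regParent d)^[j] y := by
  induction i with
  | zero => simp at h; omega
  | succ i ih =>
    rw [Function.iterate_succ_apply'] at h
    rcases Nat.eq_zero_or_pos ((regParent d)^[i] y) with h0 | h0
    -- As `0` is its own parent, the iteration may already have stopped at `x = 0`.
    · exact ih (by rw [h, h0, regParent_zero])
    · exact ⟨_, i, h0, h.symm, rfl⟩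

/-- Shrink the path from both ends: `y` moves to its parent and `x` one step towards `y`.
Breadth-first order keeps the first end below the second until they meet at a vertex (`u = u'`) or
become adjacent (`u = b`, `u' = a`). The last three conjuncts record the inward directions, which
ensure that the walks rebuilt outwards never backtrack. -/
theorem exists_regReach {x y : ℕ} (hxy : x < y) :
    ∃ u a u' b m w w', a < b ∧ u' = regParent d b ∧ (regularTree d).Adj u a ∧
      (u = u' ∨ u = b ∧ u' = a) ∧ RegReach d u a m w x ∧ RegReach d u' b m w' y ∧
      (regularTree d).Adj x w ∧ Toward d y x w ∧ w' = regParent d y := by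
  induction y using Nat.strong_induction_on generalizing x with
  | _ y ih =>
  have hy : 0 < y := by omega
  have hpy := regParent_lt (d := d) hy
  have hstepY : ∀ {u' b m w'}, RegReach d u' b m w' (regParent d y) →
      w' = regParent d (regParent d y) → 0 < regParent d y →
      RegReach d u' b (m + 1) (regParent d y) y := fun h hw hpos =>
    h.step (hw ▸ (regularTree_adj_parent hpos).symm) (regularTree_adj_parent hy)
      (by have := regParent_le d (regParent d y); omega)
  by_cases hanc : ∃ i, x = (regParent d)^[i] y
  · obtain ⟨i, hi⟩ := hanc
    obtain ⟨x₁, j, hx1, hpx, hj⟩ := exists_child_ancestor hi hxy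
    have htow : Toward d y x x₁ := Or.inl ⟨⟨j, hj⟩, hpx, hx1⟩
    have hadj : (regularTree d).Adj x x₁ := hpx ▸ regularTree_adj_parent hx1
    cases j with
    | zero =>
      obtain rfl : x₁ = y := hj
      exact ⟨x₁, x, x, x₁, 0, x₁, x, hxy, hpx.symm, hadj.symm, Or.inr ⟨rfl, rfl⟩,
        ⟨1, rfl⟩, ⟨1, rfl⟩, hadj, htow, hpx.symm⟩
    | succ j =>
      rw [Function.iterate_succ_apply] at hj
      have hle : x₁ ≤ regParent d y := hj ▸ regParent_iterate_le d j _
      rcases hle.eq_or_lt with heq | hlt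
      · exact ⟨x₁, x, x₁, y, 0, x₁, x₁, hxy, heq, hadj.symm, Or.inl rfl,
          ⟨1, rfl⟩, ⟨1, rfl⟩, hadj, htow, heq⟩
      · obtain ⟨u, a, u', b, m, w, w', h1, h2, h3, h4, h5, h6, h7, h8, h9⟩ := ih _ hpy hlt
        refine ⟨u, a, u', b, m + 1, x₁, regParent d y, h1, h2, h3, h4,
          h5.step h7 hadj.symm ?_, hstepY h6 h9 (by omega), hadj, htow, rfl⟩
        rcases h8 with ⟨-, h8, h8'⟩ | ⟨h8, -⟩
        · rintro rfl
          have := regParent_lt (d := d) h8'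
          have := regParent_lt (d := d) hx1
          omega
        · exact absurd ⟨j, hj⟩ h8
  · have hx0 : 0 < x := Nat.pos_of_ne_zero fun h0 =>
      hanc (h0 ▸ exists_regParent_iterate_eq_zero d y)
    have htow : Toward d y x (regParent d x) := Or.inr ⟨hanc, rfl⟩
    have hadj : (regularTree d).Adj x (regParent d x) := (regularTree_adj_parent hx0).symm
    rcases (regParent_mono d hxy.le).eq_or_lt with heq | hlt
    · exact ⟨regParent d x, x, regParent d x, y, 0, regParent d x, regParent d x, hxy, heq,
        hadj.symm, Or.inl rfl, ⟨1, rfl⟩, ⟨1, rfl⟩, hadj, htow, heq⟩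
    · obtain ⟨u, a, u', b, m, w, w', h1, h2, h3, h4, h5, h6, h7, h8, h9⟩ := ih _ hpy hlt
      refine ⟨u, a, u', b, m + 1, regParent d x, regParent d y, h1, h2, h3, h4,
        h5.step h7 hadj.symm ?_, hstepY h6 h9 (by omega), hadj, htow, rfl⟩
      rintro rfl
      rcases h8 with ⟨⟨i, hi⟩, -, -⟩ | ⟨h8, h8'⟩
      · exact hanc ⟨i + 1, by rw [Function.iterate_succ_apply]; exact hi⟩
      · have := regParent_lt (d := d) hx0
        have := regParent_le d (regParent d x)
        omega

end RegularTree

/-! ### Polarizing down to an initial segment. -/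

/-- Moving the vertices of the branch `N` to their free mirror images in the branch `P`, where
mirror images in `P` have smaller labels. -/
theorem exists_isPolarization {H : Type*} {P N : H → ℕ} (hP : Function.Injective P)
    (hN : Function.Injective N) (hPN : ∀ z z', P z ≠ N z') (hlt : ∀ z, P z < N z)
    {S : Finset ℕ} {z₀ : H} (h₀ : P z₀ ∉ S) (h₀' : N z₀ ∈ S) :
    ∃ S', IsPolarization P N S S' ∧ S'.card = S.card ∧ ∑ a ∈ S', a < ∑ a ∈ S, a := by
  classical
  have hg : ∀ a, ∃ b, (∀ z, a = N z → P z ∉ S → b = P z) ∧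
      ((∀ z, a = N z → P z ∈ S) → b = a) := by
    intro a
    by_cases h : ∃ z, a = N z ∧ P z ∉ S
    · obtain ⟨z, rfl, hz⟩ := h
      exact ⟨P z, fun z' hz' _ => by rw [hN hz'], fun h => absurd (h z rfl) hz⟩
    · push Not at h
      exact ⟨a, fun z hz hz' => absurd (h z hz) hz', fun _ => rfl⟩
  choose g hg1 hg2 using hg
  have hcase : ∀ a, (∃ z, a = N z ∧ P z ∉ S ∧ g a = P z) ∨
      ((∀ z, a = N z → P z ∈ S) ∧ g a = a) := fun a => by
    by_cases h : ∃ z, a = N z ∧ P z ∉ S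
    · obtain ⟨z, hz, hz'⟩ := h
      exact Or.inl ⟨z, hz, hz', hg1 a z hz hz'⟩
    · push Not at h
      exact Or.inr ⟨h, hg2 a h⟩
  have hinj : Set.InjOn g S := by
    intro a ha b hb hab
    rcases hcase a with ⟨z, rfl, hz, hgz⟩ | ⟨-, hga⟩ <;>
      rcases hcase b with ⟨z', rfl, hz', hgz'⟩ | ⟨-, hgb⟩
    · rw [hP (hgz.symm.trans (hab.trans hgz'))]
    · rw [hgz, hgb] at hab; exact absurd (hab ▸ hb) hz
    · rw [hga, hgz'] at hab; exact absurd (hab ▸ ha) hz'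
    · rw [← hga, ← hgb, hab]
  refine ⟨S.image g, ⟨fun z => ?_, fun z => ?_, fun a h1 h2 => ?_⟩,
    Finset.card_image_of_injOn hinj, ?_⟩
  · rw [Finset.mem_image]
    constructor
    · rintro ⟨a, ha, hga⟩
      rcases hcase a with ⟨z', rfl, hz', hgz'⟩ | ⟨-, hga'⟩
      · rw [hP (hga.symm.trans hgz')]; exact Or.inr ha
      · rw [← hga, hga']; exact Or.inl ha
    · intro h
      by_cases hz : P z ∈ S
      · exact ⟨P z, hz, hg2 _ fun z' hz' => absurd hz' (hPN z z')⟩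
      · exact ⟨N z, h.resolve_left hz, hg1 _ z rfl hz⟩
  · rw [Finset.mem_image]
    constructor
    · rintro ⟨a, ha, hga⟩
      rcases hcase a with ⟨z', rfl, hz', hgz'⟩ | ⟨hz', hga'⟩
      · exact absurd (hgz'.symm.trans hga) (hPN _ _)
      · obtain rfl : a = N z := hga'.symm.trans hga
        exact ⟨hz' z rfl, ha⟩
    · rintro ⟨h1, h2⟩
      exact ⟨N z, h2, hg2 _ fun z' hz' => hN hz' ▸ h1⟩
  · rw [Finset.mem_image]
    constructor
    · rintro ⟨b, hb, hgb⟩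
      rcases hcase b with ⟨z', rfl, hz', hgz'⟩ | ⟨-, hgb'⟩
      · exact absurd (hgb.symm.trans hgz') (h1 z')
      · rw [← hgb, hgb']; exact hb
    · intro ha
      exact ⟨a, ha, hg2 _ fun z hz => absurd hz (h2 z)⟩
  · rw [Finset.sum_image hinj]
    refine Finset.sum_lt_sum (fun a _ => ?_) ⟨N z₀, h₀', ?_⟩
    · rcases hcase a with ⟨z, rfl, -, hgz⟩ | ⟨-, hga⟩
      · rw [hgz]; exact (hlt z).le
      · rw [hga]
    · rw [hg1 _ z₀ rfl h₀]; exact hlt z₀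

theorem exists_moment_increasing_move {d : ℕ} [NeZero d] {S : Finset ℕ} {x y : ℕ} (hxy : x < y)
    (hx : x ∉ S) (hy : y ∈ S) :
    ∃ S' : Finset ℕ, S'.card = S.card ∧ ∑ a ∈ S', a < ∑ a ∈ S, a ∧
      ∀ k, finsetMoment (regularTree d) S (k + 1) ≤ finsetMoment (regularTree d) S' (k + 1) := by
  obtain ⟨u, a, u', b, m, w, w', hab, hu', hua, hcase, ⟨π, hπ⟩, ⟨π', hπ'⟩, -⟩ :=
    exists_regReach (d := d) hxy
  have hb : 0 < b := by omega
  have hub : (regularTree d).Adj u' b := hu' ▸ regularTree_adj_parent hb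
  have hup : u' = regUp d b := by rw [hu', regUp, if_neg hb.ne']
  have hPx : regWalk d u a π (List.replicate m 0) = x := congrArg Prod.snd hπ
  have hNy : regWalk d u' b π' (List.replicate m 0) = y := congrArg Prod.snd hπ'
  have hadj : ∀ z z', (regularTree d).Adj (regWalk d u a π z) (regWalk d u a π z') ↔
      (regularTree d).Adj (regWalk d u' b π' z) (regWalk d u' b π' z') := fun z z' => by
    rw [regWalk_adj_iff hua, regWalk_adj_iff hub]
  have hPN : ∀ z z', regWalk d u a π z ≠ regWalk d u' b π' z' := by
    rcases hcase with rfl | ⟨rfl, rfl⟩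
    · exact regWalk_ne_regWalk hua hub hab.ne
    · exact regWalk_ne_regWalk_reverse hua
  obtain ⟨S', hS', hcard, hsum⟩ := exists_isPolarization (regWalk_injective hua)
    (regWalk_injective hub) hPN (fun z => by subst hup; exact regWalk_lt_regWalk hab z z rfl)
    (hPx ▸ hx) (hNy ▸ hy)
  refine ⟨S', hcard, hsum, fun k => ?_⟩
  rcases hcase with rfl | ⟨rfl, rfl⟩
  · exact finsetMoment_le_of_vertex (regWalk_isBranch hua) (regWalk_isBranch hub) hPN hadj hS' k
  · exact finsetMoment_le_of_edge (c := []) (regWalk_isBranch hua) (regWalk_isBranch hub) hPN hadj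
      hS' k

/-- Descent on the sum of the labels; a set with no gap below any element is an initial segment. -/
theorem finsetMoment_le_range (d : ℕ) [NeZero d] (S : Finset ℕ) (k : ℕ) :
    finsetMoment (regularTree d) S (k + 1) ≤
      finsetMoment (regularTree d) (Finset.range S.card) (k + 1) := by
  induction hs : ∑ a ∈ S, a using Nat.strong_induction_on generalizing S with
  | _ s ih =>
  by_cases hdc : ∀ y ∈ S, ∀ x < y, x ∈ S
  · have : S = Finset.range S.card := by
      refine Finset.eq_of_subset_of_card_le (fun y hy => ?_) (by simp)
      have hsub : Finset.range (y + 1) ⊆ S := fun x hx => by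
        rcases (Nat.lt_succ_iff.1 (Finset.mem_range.1 hx)).eq_or_lt with rfl | h
        · exact hy
        · exact hdc y hy x h
      have := Finset.card_le_card hsub
      rw [Finset.card_range] at this
      exact Finset.mem_range.2 (by omega)
    rw [← this]
  · push Not at hdc
    obtain ⟨y, hy, x, hxy, hx⟩ := hdc
    obtain ⟨S', hcard, hsum, hle⟩ := exists_moment_increasing_move (d := d) hxy hx hy
    have := ih _ (hs ▸ hsum) S' rfl
    rw [hcard] at this
    exact (hle k).trans this

/-! ### Embedding a finite tree in the regular tree. -/

section Embedding

variable {V : Type*} [Fintype V] [DecidableEq V] {T : SimpleGraph V} [DecidableRel T.Adj]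

/-- A tree is the graph of a parent function that decreases the distance to a given root. -/
theorem SimpleGraph.IsTree.exists_parent (hT : T.IsTree) (r : V) :
    ∃ par : V → V, (∀ v, v ≠ r → T.Adj v (par v) ∧ T.dist v r = T.dist (par v) r + 1) ∧
      ∀ u v, T.Adj u v → (u ≠ r ∧ v = par u) ∨ (v ≠ r ∧ u = par v) := by
  have hex : ∀ v, ∃ p, v ≠ r → T.Adj v p ∧ T.dist v r = T.dist p r + 1 := by
    intro v
    by_cases hv : v = r
    · exact ⟨v, fun h => absurd hv h⟩
    obtain ⟨q, hq⟩ := hT.connected.exists_walk_length_eq_dist v r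
    cases q with
    | nil => exact absurd rfl hv
    | @cons _ w _ h q =>
      refine ⟨w, fun _ => ⟨h, ?_⟩⟩
      have h1 := T.dist_le q
      have h2 := hT.connected.dist_triangle (u := v) (v := w) (w := r)
      have h3 := T.dist_eq_one_iff_adj.2 h
      rw [SimpleGraph.Walk.length_cons] at hq
      omega
  choose par hpar using hex
  refine ⟨par, hpar, ?_⟩
  have hinj : Set.InjOn (fun v => s(v, par v)) ((Finset.univ.erase r : Finset V) : Set V) := by
    intro u hu v hv huv
    have hu' := (hpar u (Finset.ne_of_mem_erase hu)).2
    have hv' := (hpar v (Finset.ne_of_mem_erase hv)).2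
    rcases Sym2.eq_iff.1 huv with ⟨h, -⟩ | ⟨h1, h2⟩
    · exact h
    · rw [h2] at hu'; rw [← h1] at hv'; omega
  have hsub : (Finset.univ.erase r).image (fun v => s(v, par v)) ⊆ T.edgeFinset := by
    intro e he
    obtain ⟨v, hv, rfl⟩ := Finset.mem_image.1 he
    rw [SimpleGraph.mem_edgeFinset]
    exact (hpar v (Finset.ne_of_mem_erase hv)).1
  -- The parent edges are `|V| - 1` distinct edges, hence all edges of the tree.
  have heq := Finset.eq_of_subset_of_card_le hsub (by
    rw [Finset.card_image_of_injOn hinj, Finset.card_erase_of_mem (Finset.mem_univ r),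
      Finset.card_univ]
    have := hT.card_edgeFinset
    omega)
  intro u v huv
  have : s(u, v) ∈ T.edgeFinset := SimpleGraph.mem_edgeFinset.2 huv
  rw [← heq] at this
  obtain ⟨w, hw, hwe⟩ := Finset.mem_image.1 this
  have hwr := Finset.ne_of_mem_erase hw
  rcases Sym2.eq_iff.1 hwe with ⟨rfl, h⟩ | ⟨rfl, h⟩
  · exact Or.inl ⟨hwr, h.symm⟩
  · exact Or.inr ⟨hwr, h.symm⟩

theorem SimpleGraph.IsTree.exists_regularTree_embedding (hT : T.IsTree) (d : ℕ) [NeZero d]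
    (hdeg : ∀ v, T.degree v ≤ d + 1) :
    ∃ f : V → ℕ, Function.Injective f ∧
      ∀ u v, T.Adj u v → (regularTree d).Adj (f u) (f v) := by
  have hd : 0 < d := NeZero.pos d
  rcases subsingleton_or_nontrivial V with hV | hV
  · exact ⟨fun _ => 0, Function.injective_of_subsingleton _, fun u v h =>
      absurd (Subsingleton.elim u v) h.ne⟩
  -- Rooting at a leaf leaves every vertex, the root included, with at most `d` children, so the
  -- slots `regChild` suffice.
  obtain ⟨r, hr⟩ := hT.exists_vert_degree_one_of_nontrivial
  obtain ⟨par, hpar, hadj⟩ := hT.exists_parent r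
  have hcard : ∀ p, (Finset.univ.filter fun v => v ≠ r ∧ par v = p).card ≤ d := by
    intro p
    have hsub : (Finset.univ.filter fun v => v ≠ r ∧ par v = p) ⊆ T.neighborFinset p := by
      intro v hv
      obtain ⟨-, hv1, rfl⟩ := Finset.mem_filter.1 hv
      exact (T.mem_neighborFinset _ _).2 (hpar v hv1).1.symm
    by_cases hp : p = r
    · have := Finset.card_le_card hsub
      rw [T.card_neighborFinset_eq_degree, hp, hr] at this
      rw [hp]; omega
    · have hss : (Finset.univ.filter fun v => v ≠ r ∧ par v = p) ⊂ T.neighborFinset p := by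
        refine hsub.ssubset_of_mem_notMem ((T.mem_neighborFinset _ _).2 (hpar p hp).1) ?_
        intro hm
        obtain ⟨-, h1, h2⟩ := Finset.mem_filter.1 hm
        have h3 := (hpar p hp).2
        have h4 := (hpar _ h1).2
        rw [h2] at h4; omega
      have := Finset.card_lt_card hss
      rw [T.card_neighborFinset_eq_degree] at this
      have := hdeg p
      omega
  have hemb : ∀ p, Nonempty ((Finset.univ.filter fun v => v ≠ r ∧ par v = p) ↪ Fin d) := fun p =>
    Function.Embedding.nonempty_of_card_le (by rw [Fintype.card_coe, Fintype.card_fin]; exact hcard p)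
  let e := fun p => (hemb p).some
  have hlab : ∃ l : V → Fin d, ∀ u v, u ≠ r → v ≠ r → par u = par v → l u = l v → u = v := by
    refine ⟨fun v => if h : v ≠ r then e (par v) ⟨v, by simp [h]⟩ else 0, ?_⟩
    intro u v hu hv hp hl
    simp only [dif_pos hu, dif_pos hv] at hl
    have : ∀ (q : V) (hq : v ∈ Finset.univ.filter fun v => v ≠ r ∧ par v = q) (hq' : par v = q),
        e (par v) ⟨v, by simp [hv]⟩ = e q ⟨v, hq⟩ := by
      rintro q hq rfl; rfl
    rw [this (par u) (by simp [hv, hp]) hp.symm] at hl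
    exact congrArg Subtype.val ((e _).injective hl)
  obtain ⟨l, hl⟩ := hlab
  -- The distance to the root serves as the recursion depth for placing each vertex below its
  -- parent.
  let g : ℕ → V → ℕ := fun k => Nat.rec (fun _ => 0) (fun _ h v => regChild d (h (par v)) (l v)) k
  let f : V → ℕ := fun v => g (T.dist v r) v
  have hfr : f r = 0 := by simp [f, g]
  have hf : ∀ v, v ≠ r → f v = regChild d (f (par v)) (l v) := fun v hv => by
    simp only [f]
    rw [(hpar v hv).2]
  have hfpos : ∀ v, v ≠ r → 0 < f v := fun v hv => by
    rw [hf v hv]; exact (Nat.zero_le _).trans_lt (lt_regChild hd)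
  have hfpar : ∀ v, v ≠ r → regParent d (f v) = f (par v) := fun v hv => by
    rw [hf v hv, regParent_regChild (l v).2]
  have hchild : ∀ v, v ≠ r → (regularTree d).Adj (f (par v)) (f v) := fun v hv =>
    hfpar v hv ▸ regularTree_adj_parent (hfpos v hv)
  refine ⟨f, ?_, fun u v huv => ?_⟩
  · intro u
    induction hk : T.dist u r generalizing u with
    | zero =>
      intro v huv
      have hur : u = r := hT.connected.dist_eq_zero_iff.1 hk
      subst hur
      by_contra hne
      have := hfpos v (Ne.symm hne)
      omega
    | succ k ih =>
      intro v huv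
      have hu : u ≠ r := by rintro rfl; simp at hk
      have hv : v ≠ r := by
        rintro rfl
        have := hfpos u hu
        omega
      have hp : par u = par v := ih (by have := (hpar u hu).2; omega)
        (by rw [← hfpar u hu, ← hfpar v hv, huv])
      refine hl u v hu hv hp (Fin.ext ?_)
      rw [hf u hu, hf v hv, hp] at huv
      unfold regChild at huv
      omega
  · rcases hadj u v huv with ⟨hu, rfl⟩ | ⟨hv, rfl⟩
    · exact (hchild u hu).symm
    · exact hchild v hv

end Embedding

/-! ### Spectral moments as counts of closed walks. -/

section Spectrum

variable {V : Type*} [Fintype V] [DecidableEq V]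

theorem spectralMoment_eq_trace (G : SimpleGraph V) [DecidableRel G.Adj] (k : ℕ) :
    spectralMoment G k = (G.adjMatrix ℝ ^ k).trace := by
  have hA := G.isHermitian_adjMatrix ℝ
  conv_rhs => rw [hA.spectral_theorem, ← map_pow, Unitary.conjStarAlgAut_apply,
    Matrix.trace_mul_comm, ← mul_assoc]
  simp [spectralMoment, Matrix.diagonal_pow, Matrix.trace_diagonal]

theorem hasSum_estradaIndex (G : SimpleGraph V) [DecidableRel G.Adj] :
    HasSum (fun k : ℕ => spectralMoment G k / k.factorial) (estradaIndex G) := by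
  unfold spectralMoment estradaIndex
  simp only [Finset.sum_div]
  refine hasSum_sum fun i _ => ?_
  rw [Real.exp_eq_exp_ℝ]
  exact NormedSpace.expSeries_div_hasSum_exp _

theorem spectralMoment_zero (G : SimpleGraph V) [DecidableRel G.Adj] :
    spectralMoment G 0 = Fintype.card V := by
  simp [spectralMoment]

/-- The image need not be induced: extra edges only add closed walks. -/
theorem spectralMoment_le_finsetMoment {α : Type*} [DecidableEq α] {T : SimpleGraph V}
    [DecidableRel T.Adj] {G : SimpleGraph α} {f : V → α} (hf : Function.Injective f)
    (hadj : ∀ u v, T.Adj u v → G.Adj (f u) (f v)) (k : ℕ) :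
    spectralMoment T (k + 1) ≤ finsetMoment G (Finset.univ.image f) (k + 1) := by
  rw [spectralMoment_eq_trace, ← trace_adjOn_pow G (Finset.univ.image f) hf (by simp)]
  refine trace_pow_le_of_le (fun i j => ?_) (fun i j => ?_) _
  · rw [SimpleGraph.adjMatrix_apply]; split_ifs <;> simp
  · rw [SimpleGraph.adjMatrix_apply]
    split_ifs with h
    · simp [adjOn, ind_of_true, hadj i j h]
    · exact ind_nonneg _

theorem spectralMoment_eq_finsetMoment {α : Type*} [DecidableEq α] {T : SimpleGraph V}
    [DecidableRel T.Adj] {G : SimpleGraph α} {f : V → α} (hf : Function.Injective f)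
    (hadj : ∀ u v, T.Adj u v ↔ G.Adj (f u) (f v)) {S : Finset α} (hS : Finset.univ.image f = S)
    (k : ℕ) : spectralMoment T (k + 1) = finsetMoment G S (k + 1) := by
  subst hS
  rw [spectralMoment_eq_trace, ← trace_adjOn_pow G (Finset.univ.image f) hf (by simp)]
  congr 2
  ext i j
  by_cases h : T.Adj i j
  · simp [adjOn, h, ind_of_true, (hadj i j).1 h]
  · simp [adjOn, h, ind_of_false, mt (hadj i j).2 h]

end Spectrum

/-! ### The Volkmann tree as an initial segment. -/

section Volkmann

theorem volkmannParent_eq_regParent {Δ d j : ℕ} (hd : d = max (Δ - 1) 1)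
    (hj : 2 ≤ Δ ∨ j ≤ Δ) : volkmannParent Δ j = regParent d j := by
  unfold volkmannParent regParent
  split_ifs with h
  · rw [Nat.div_eq_of_lt]
    omega
  · have hd' : d = Δ - 1 := by omega
    rw [hd', show j - 2 = (j - (Δ + 1)) + (Δ - 1) by omega, Nat.add_div_right _ (by omega)]

variable {n Δ d : ℕ}

theorem volkmannTree_adj (hd : d = max (Δ - 1) 1) (hn : 2 ≤ Δ ∨ n ≤ Δ + 1) (i j : Fin n) :
    (volkmannTree n Δ).Adj i j ↔ (regularTree d).Adj i j := by
  have hi := volkmannParent_eq_regParent (j := i) hd (by omega)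
  have hj := volkmannParent_eq_regParent (j := j) hd (by omega)
  rw [volkmannTree, SimpleGraph.fromRel_adj, hi, hj]
  exact ⟨fun h => h.2, fun h => ⟨fun hij => h.ne (congrArg Fin.val hij), h⟩⟩

theorem volkmannTree_isTree (hn0 : 0 < n) (hn : 2 ≤ Δ ∨ n ≤ Δ + 1) :
    (volkmannTree n Δ).IsTree := by
  obtain ⟨d, hd⟩ : ∃ d, d = max (Δ - 1) 1 := ⟨_, rfl⟩
  have hadj := volkmannTree_adj hd hn
  let par : Fin n → Fin n := fun j => ⟨regParent d j, (regParent_le d j).trans_lt j.2⟩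
  have hreach : ∀ k (hk : k < n), (volkmannTree n Δ).Reachable ⟨k, hk⟩ ⟨0, hn0⟩ := by
    intro k
    induction k using Nat.strong_induction_on with
    | _ k ih =>
      intro hk
      rcases Nat.eq_zero_or_pos k with rfl | hpos
      · exact SimpleGraph.Reachable.refl _
      · have hlt := regParent_lt (d := d) hpos
        have h1 : (volkmannTree n Δ).Adj ⟨k, hk⟩ ⟨regParent d k, hlt.trans hk⟩ :=
          (hadj _ _).2 (regularTree_adj_parent hpos).symm
        exact h1.reachable.trans (ih _ hlt _)
  have : Nonempty (Fin n) := ⟨⟨0, hn0⟩⟩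
  have hconn : (volkmannTree n Δ).Connected :=
    ⟨fun i j => (hreach i i.2).trans (hreach j j.2).symm⟩
  -- Connectedness bounds the number of edges below; each edge joins a nonzero vertex to its parent,
  -- which bounds it above.
  rw [SimpleGraph.isTree_iff_connected_and_card]
  refine ⟨hconn, le_antisymm ?_ hconn.card_vert_le_card_edgeSet_add_one⟩
  have hsub : (volkmannTree n Δ).edgeFinset ⊆
      (Finset.univ.erase (⟨0, hn0⟩ : Fin n)).image fun j => s(par j, j) := by
    intro e he
    induction e using Sym2.ind with
    | _ i j =>
      rw [SimpleGraph.mem_edgeFinset, SimpleGraph.mem_edgeSet, hadj] at he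
      rw [Finset.mem_image]
      rcases he with ⟨h1, h2⟩ | ⟨h1, h2⟩
      · refine ⟨j, by simp [Fin.ext_iff, h1.ne'], ?_⟩
        rw [show par j = i from Fin.ext h2.symm]
      · refine ⟨i, by simp [Fin.ext_iff, h1.ne'], ?_⟩
        rw [show par i = j from Fin.ext h2.symm, Sym2.eq_swap]
  have h1 := (Finset.card_le_card hsub).trans Finset.card_image_le
  rw [Finset.card_erase_of_mem (Finset.mem_univ _), Finset.card_univ, Fintype.card_fin,
    SimpleGraph.edgeFinset_card, ← Nat.card_eq_fintype_card] at h1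
  rw [Nat.card_eq_fintype_card (α := Fin n), Fintype.card_fin]
  omega

theorem volkmannTree_maxDegree (hn0 : Δ < n) (hn : 2 ≤ Δ ∨ n ≤ Δ + 1) :
    (volkmannTree n Δ).maxDegree = Δ := by
  obtain ⟨d, hd⟩ : ∃ d, d = max (Δ - 1) 1 := ⟨_, rfl⟩
  have : NeZero d := ⟨by omega⟩
  have : Nonempty (Fin n) := ⟨⟨0, by omega⟩⟩
  have hadj := volkmannTree_adj hd hn
  apply le_antisymm
  · rcases hn with h2 | h1
    · refine SimpleGraph.maxDegree_le_of_forall_degree_le _ _ fun i => ?_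
      rw [← SimpleGraph.card_neighborFinset_eq_degree,
        ← Finset.card_image_of_injective _ Fin.val_injective]
      have hsub : ((volkmannTree n Δ).neighborFinset i).image Fin.val ⊆
          insert (regUp d i) (Finset.univ.image fun s : Fin d => regChild d i s) := by
        intro b hb
        obtain ⟨j, hj, rfl⟩ := Finset.mem_image.1 hb
        rw [SimpleGraph.mem_neighborFinset, hadj, regularTree_adj_iff] at hj
        rcases hj with hj | ⟨s, hs⟩
        · simp [hj]
        · simp [hs]
      refine (Finset.card_le_card hsub).trans ((Finset.card_insert_le _ _).trans ?_)
      have := Finset.card_image_le (s := (Finset.univ : Finset (Fin d)))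
        (f := fun s : Fin d => regChild d i s)
      rw [Finset.card_univ, Fintype.card_fin] at this
      omega
    · have := (volkmannTree n Δ).maxDegree_lt_card_verts
      rw [Fintype.card_fin] at this
      omega
  · refine le_trans ?_ ((volkmannTree n Δ).degree_le_maxDegree ⟨0, by omega⟩)
    rw [← SimpleGraph.card_neighborFinset_eq_degree]
    have := Finset.card_le_card_of_injOn (s := (Finset.univ : Finset (Fin Δ)))
      (t := (volkmannTree n Δ).neighborFinset ⟨0, by omega⟩)
      (fun s => ⟨s + 1, by omega⟩) (fun s _ => ?_) (fun s _ t _ h => ?_)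
    · simpa using this
    · simp only [Finset.mem_coe, SimpleGraph.mem_neighborFinset]
      rw [volkmannTree, SimpleGraph.fromRel_adj]
      refine ⟨by simp [Fin.ext_iff], Or.inl ⟨by simp, ?_⟩⟩
      have : s.1 + 1 ≤ Δ := s.2
      simp [volkmannParent, this]
    · have := congrArg Fin.val h
      exact Fin.ext (by simpa using this)

end Volkmann

theorem mainTheorem3 (n Δ : ℕ) {V : Type*} [Fintype V] [DecidableEq V]
    (T : SimpleGraph V) [DecidableRel T.Adj] (hT : T.IsTree)
    (hn : Fintype.card V = n) (hΔ : T.maxDegree = Δ) :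
    ((volkmannTree n Δ).IsTree ∧ (volkmannTree n Δ).maxDegree = Δ) ∧
      (∀ k : ℕ, spectralMoment T (2 * k) ≤ spectralMoment (volkmannTree n Δ) (2 * k)) ∧
      estradaIndex T ≤ estradaIndex (volkmannTree n Δ) := by
  have : Nonempty V := hT.connected.nonempty
  have hlt : Δ < n := by
    rw [← hn, ← hΔ]; exact T.maxDegree_lt_card_verts
  -- By the handshake lemma `2 (n - 1) ≤ n Δ`, so `Δ ≤ 1` leaves only the trees with one or two
  -- vertices.
  have hsmall : 2 ≤ Δ ∨ n ≤ Δ + 1 := by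
    by_contra! h
    have h1 := T.sum_degrees_eq_twice_card_edges
    have h2 := hT.card_edgeFinset
    have h3 : ∑ v, T.degree v ≤ ∑ _v : V, Δ :=
      Finset.sum_le_sum fun v _ => hΔ ▸ T.degree_le_maxDegree v
    rw [Finset.sum_const, Finset.card_univ, smul_eq_mul, hn] at h3
    rw [hn] at h2
    have h4 : n * Δ ≤ n * 1 := Nat.mul_le_mul_left n (by omega)
    rcases Nat.eq_zero_or_pos Δ with h0 | h0
    · rw [h0, mul_zero] at h3; omega
    · omega
  obtain ⟨d, hd⟩ : ∃ d, d = max (Δ - 1) 1 := ⟨_, rfl⟩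
  have : NeZero d := ⟨by omega⟩
  obtain ⟨f, hf, hadj⟩ := hT.exists_regularTree_embedding d fun v => by
    have := T.degree_le_maxDegree v
    omega
  -- The walk comparison ignores parity; having it for every `k` makes the exponential series
  -- comparable term by term.
  have hle : ∀ k, spectralMoment T k ≤ spectralMoment (volkmannTree n Δ) k := by
    intro k
    cases k with
    | zero => rw [spectralMoment_zero, spectralMoment_zero, hn, Fintype.card_fin]
    | succ k =>
      have h1 := spectralMoment_le_finsetMoment hf hadj k
      have h2 := finsetMoment_le_range d (Finset.univ.image f) k
      rw [Finset.card_image_of_injective _ hf, Finset.card_univ, hn] at h2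
      rw [spectralMoment_eq_finsetMoment (S := Finset.range n) Fin.val_injective
        (volkmannTree_adj hd hsmall) (by ext a; simp [Fin.exists_iff]) k]
      exact h1.trans h2
  refine ⟨⟨volkmannTree_isTree (by omega) hsmall, volkmannTree_maxDegree hlt hsmall⟩,
    fun k => hle _, ?_⟩
  exact hasSum_le (fun k => div_le_div_of_nonneg_right (hle k) (Nat.cast_nonneg _))
    (hasSum_estradaIndex T) (hasSum_estradaIndex _)
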